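/- Let $E_0\subseteq\omega_1$ be stationary and co-stationary, and let $\mathfrak D$ be the club filter on $\omega_1$ restricted to $\omega_1\setminus E_0$, i.e. the filter generated by the sets $C\setminus E_0$ with $C\subseteq\omega_1$ closed unbounded. Write $\mathfrak D^+$ for the family of $S\subseteq\omega_1$ with $\omega_1\setminus S\notin\mathfrak D$. Assume that $\mathfrak D$ has diamonds: for every $S\in\mathfrak D^+$ there is a sequence $\langle B_\delta:\delta\in S\rangle$ such that $\{\delta\in S: X\cap\delta=B_\delta\}\in\mathfrak D^+$ for every $X\subseteq\omega_1$. Let $S^{\omega_2}_{\omega_1}=\{\delta<\omega_2:\operatorname{cf}(\delta)=\omega_1\}$, and for each $\delta\in S^{\omega_2}_{\omega_1}$ let $\eta_\delta$ be a strictly increasing continuous function from $\omega_1$ onto a cofinal subset of $\delta$ and let $c_\delta:\omega_1\to\{0,1\}$ be arbitrary. Let $P$ be the set of all partial functions $p$ from $\omega_2$ to $\{0,1\}$ with $|\operatorname{dom}(p)|\le\aleph_1$ such that for every $\delta\in S^{\omega_2}_{\omega_1}$ the set $$\{i\in E_0:\ \eta_\delta(i)\in\operatorname{dom}(p)\ \text{and}\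 p(\eta_\delta(i))\ne c_\delta(i)\}$$ is nonstationary, ordered by $q\le p\iff p\subseteq q$. Then $P$ is proper over $\mathfrak D$-diamonds, which means the following. For all sufficiently large regular $\chi$ there is $x\in H(\chi)$ such that whenever * $N$ is an elementary submodel of $(H(\chi),\in)$ with $P,x\in N$, $|N|=\aleph_1$, $N^{<\omega_1}\subseteq N$; * $\langle N_\alpha:\alpha<\omega_1\rangle$ is a filtration of $N$, i.e. a continuous $\in$-increasing sequence of countable elementary submodels of $H(\chi)$ with union $N$ and $\langle N_\beta:\beta\le\alpha\rangle\in N_{\alpha+1}$ for all $\alpha<\omega_1$; * $\bar R=\langle (A_\delta,q_\delta):\delta\in S\rangle$ is an $(N,P)$-rule, i.e. $S\in\mathfrak D^+$; each $A_\delta$ is a subset of $N_\delta\cap P$; for every $A\subseteq N\cap P$ all of whose countable subsets have a lower bound in $P$, $\{\delta\in S:N_\delta\cap A=A_\delta\}\in\mathfrak D^+$; each $q_\delta\in N\cap P$ is a lower bound of $A_\delta$; and for every dense open $D\subseteq P$ with $D\in N$, $q_\delta\in D$ for all sufficiently large $\delta\in S$; then for every $p\in N\cap P$ there is $q\le p$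 in $P$ that is $(N,P,\bar R)$-generic, i.e. $q$ forces: "there is $C\in\mathfrak D$ such that for all $\delta\in S\cap C$, if $N_\delta\cap\dot G_P=A_\delta$, then $q_\delta\in\dot G_P$". (In the generic extension, $\mathfrak D$ denotes the normal filter generated by the ground model $\mathfrak D$.) -/

import Mathlib

open Cardinal Set

universe u

noncomputable section

namespace OverDiamonds

/-! ### Filters on a regular cardinal, clubs and diamonds

A cardinal `κ` is identified with the set of ordinals below `κ.ord`. -/

/-- The set of ordinals below the cardinal `κ`. -/
abbrev Below (κ : Cardinal.{u}) : Type (u + 1) := Set.Iio κ.ord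

/-- `S ∈ 𝔇⁺`: the set `S` is positive with respect to the filter `𝔇`. -/
def Positive {I : Type*} (D : Filter I) (S : Set I) : Prop := Sᶜ ∉ D

/-- The filter on `κ` generated by the closed unbounded subsets of `κ`. -/
def clubFilter (κ : Cardinal.{u}) : Filter (Below κ) :=
  Filter.generate {C | IsClub C}

/-- The club filter restricted to `κ ∖ E`. -/
def clubFilterOff (κ : Cardinal.{u}) (E : Set (Below κ)) : Filter (Below κ) :=
  clubFilter κ ⊓ Filter.principal Eᶜ

/-- The filter `𝔇` on `κ` has diamonds: every `S ∈ 𝔇⁺` carries a sequence `⟨A δ : δ ∈ S⟩` such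
that for every `X ⊆ κ` the set of `δ ∈ S` with `X ∩ δ = A δ` is in `𝔇⁺`. -/
def HasDiamonds {κ : Cardinal.{u}} (D : Filter (Below κ)) : Prop :=
  ∀ S : Set (Below κ), Positive D S →
    ∃ A : Below κ → Set (Below κ), ∀ X : Set (Below κ),
      Positive D {δ | δ ∈ S ∧ X ∩ Set.Iio δ = A δ}

/-! ### Elementary submodels of `H(χ)`

The universe of sets is `ZFSet`. -/

/-- The only relation symbol of the language of set theory. -/
inductive SetRel : ℕ → Type
  | mem : SetRel 2

/-- The first-order language of set theory. -/
def setLanguage : FirstOrder.Language.{0, 0} := ⟨fun _ => Empty, SetRel⟩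

/-- A collection of sets as a structure for the language of set theory. -/
instance setStructure (H : Set ZFSet.{u}) : setLanguage.Structure H where
  funMap := fun f => Empty.elim f
  RelMap := fun r => match r with
    | SetRel.mem => fun x => (x 0 : ZFSet.{u}) ∈ (x 1 : ZFSet.{u})

/-- `H(χ)`: the sets whose transitive closure has cardinality less than `χ`. -/
def Hereditary (χ : Cardinal.{u}) : Set ZFSet.{u} :=
  {x | ∃ t : ZFSet.{u}, t.IsTransitive ∧ x ⊆ t ∧ t.card < χ}

/-- The set `N` is (the universe of) an elementary submodel of `(H(χ), ∈)`. -/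
def IsElementarySubmodel (χ : Cardinal.{u}) (N : ZFSet.{u}) : Prop :=
  ∃ M : setLanguage.ElementarySubstructure (Hereditary χ),
    ∀ x : ZFSet.{u}, x ∈ N ↔ ∃ h : x ∈ Hereditary χ, (⟨x, h⟩ : Hereditary χ) ∈ M

/-- The sequence `⟨f β : β < α⟩` as a set, namely the set of ordered pairs `(β, f β)`, `β < α`. -/
def seqCode (α : Ordinal.{u}) (f : Ordinal.{u} → ZFSet.{u}) : ZFSet.{u} :=
  ZFSet.range fun β : Set.Iio α => ZFSet.pair (β : Ordinal.{u}).toZFSet (f β)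

/-- `⟨F α : α < κ⟩` is a filtration of `N`: a continuous `∈`-increasing sequence of elementary
submodels of `H(χ)` of size less than `κ` with union `N` and with
`⟨F β : β ≤ α⟩ ∈ F (α + 1)`. Values of `F` at ordinals outside `κ` play no role. -/
structure IsFiltration (κ χ : Cardinal.{u}) (N : ZFSet.{u}) (F : Ordinal.{u} → ZFSet.{u}) :
    Prop where
  elementary : ∀ α < κ.ord, IsElementarySubmodel χ (F α)
  card_lt : ∀ α < κ.ord, (F α).card < κ
  increasing : ∀ α β, α < β → β < κ.ord → F α ∈ F β
  continuous : ∀ δ < κ.ord, Order.IsSuccLimit δ → ∀ x, x ∈ F δ ↔ ∃ α < δ, x ∈ F α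
  seq_mem : ∀ α < κ.ord, seqCode (α + 1) F ∈ F (α + 1)
  union : ∀ x, x ∈ N ↔ ∃ α < κ.ord, x ∈ F α

/-- Relevant models: elementary submodels of `H(χ)` of size `κ`, closed under sequences of length
less than `κ`, that have a filtration. -/
structure IsRelevant (κ χ : Cardinal.{u}) (N : ZFSet.{u}) : Prop where
  elementary : IsElementarySubmodel χ N
  card_eq : N.card = κ
  closed : ∀ α < κ.ord, ∀ f : Ordinal.{u} → ZFSet.{u}, (∀ β < α, f β ∈ N) → seqCode α f ∈ N
  filtration : ∃ F, IsFiltration κ χ N F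

/-! ### The forcing relation

A statement about the generic extension is represented by the collection of conditions that force
it. The clauses are the usual recursive clauses of the forcing relation; `∃` and `→` are expressed
through `∀`, `∧`, `¬`. -/

section Forcing

variable {P : Type*} [Preorder P]

/-- `r ⊩ ¬ φ`: no extension of `r` forces `φ`. -/
def fNot (φ : P → Prop) : P → Prop := fun r => ∀ s ≤ r, ¬ φ s

/-- `r ⊩ φ ∧ ψ`. -/
def fAnd (φ ψ : P → Prop) : P → Prop := fun r => φ r ∧ ψ r

/-- `r ⊩ φ → ψ`. -/
def fImp (φ ψ : P → Prop) : P → Prop := fNot (fAnd φ (fNot ψ))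

/-- `r ⊩ φ ↔ ψ`. -/
def fIff (φ ψ : P → Prop) : P → Prop := fAnd (fImp φ ψ) (fImp ψ φ)

/-- `r ⊩ ∀ i, φ i`, where `i` runs over elements of the ground model or over names. -/
def fAll {ι : Sort*} (φ : ι → P → Prop) : P → Prop := fun r => ∀ i, φ i r

/-- `r ⊩ ∃ i, φ i`, where `i` runs over elements of the ground model or over names. -/
def fEx {ι : Sort*} (φ : ι → P → Prop) : P → Prop := fNot (fAll fun i => fNot (φ i))

/-- A statement about the ground model. -/
def fGround (a : Prop) : P → Prop := fun _ => a

/-- A name for a subset of the ground model set `X`: the set named by `C` in the extension by the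
generic filter `G` is `{x | C x ∩ G ≠ ∅}`. Every subset of `X` in the extension has such a name. -/
abbrev SubsetName (P : Type*) (X : Type*) := X → Set P

/-- `r ⊩ x ∈ C`: the conditions below some element of `C x` are dense below `r`. -/
def fMem {X : Type*} (x : X) (C : SubsetName P X) : P → Prop :=
  fun r => ∀ s ≤ r, ∃ t ≤ s, ∃ p ∈ C x, t ≤ p

/-- The canonical name of the generic filter, as a subset of `P`. -/
def genericName : SubsetName P P := fun p => {p}

/-- The subset of `I` named by `C` is an element of the ground model filter `D`. -/
def fMemGroundFilter {I : Type*} (D : Filter I) (C : SubsetName P I) : P → Prop :=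
  fEx fun X : {X : Set I // X ∈ D} => fAll fun j : I => fIff (fMem j C) (fGround (j ∈ X.1))

/-- The subset of `I` named by `C` is an element of the normal filter generated by `D` in the
generic extension: for some `X ∈ D` and some sequence `⟨B i : i ∈ I⟩` (in the extension) of members
of the ground model filter `D`, it contains `X ∩ {δ | ∀ i < δ, δ ∈ B i}`, the intersection of `X`
with the diagonal intersection of the sequence.
(The set `X` is there because a diagonal intersection always contains `0`.) -/
def fMemNormalFilter {I : Type*} [LT I] (D : Filter I) (C : SubsetName P I) : P → Prop :=
  fEx fun X : {X : Set I // X ∈ D} => fEx fun B : I → SubsetName P I =>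
    fAnd (fAll fun i : I => fMemGroundFilter D (B i))
      (fAll fun δ : I =>
        fImp (fAnd (fGround (δ ∈ X.1)) (fAll fun i : {i : I // i < δ} => fMem δ (B i.1)))
          (fMem δ C))

end Forcing

/-! ### Notions of forcing that are sets -/

/-- A notion of forcing: a nonempty set with a preorder on it, given as a set of ordered pairs,
`(q, p) ∈ rel` meaning `q ≤ p`. -/
structure ForcingNotion where
  carrier : ZFSet.{u}
  rel : ZFSet.{u}
  nonempty : ∃ p, p ∈ carrier
  rel_subset : rel ⊆ carrier.prod carrier
  refl : ∀ p ∈ carrier, ZFSet.pair p p ∈ rel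
  trans : ∀ p q r, ZFSet.pair p q ∈ rel → ZFSet.pair q r ∈ rel → ZFSet.pair p r ∈ rel

/-- The notion of forcing as a single set, the ordered pair of its underlying set and its order. -/
def ForcingNotion.code (P : ForcingNotion.{u}) : ZFSet.{u} := ZFSet.pair P.carrier P.rel

/-- The type of conditions. -/
def ForcingNotion.Cond (P : ForcingNotion.{u}) : Type (u + 1) := {p : ZFSet.{u} // p ∈ P.carrier}

instance (P : ForcingNotion.{u}) : Preorder P.Cond where
  le q p := ZFSet.pair q.1 p.1 ∈ P.rel
  le_refl p := P.refl p.1 p.2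
  le_trans p q r hpq hqr := P.trans p.1 q.1 r.1 hpq hqr

/-! ### Properness over diamonds -/

/-- `<κ`-linked: every subset of size less than `κ` has a lower bound in `P`. -/
def IsLinked (κ : Cardinal.{u}) (P : ForcingNotion.{u}) (X : Set P.Cond) : Prop :=
  ∀ Y ⊆ X, #Y < Cardinal.lift.{u + 1} κ → ∃ r : P.Cond, ∀ p ∈ Y, r ≤ p

/-- `⟨A δ : δ ∈ S⟩` is an `(N, P)`-diamond, for the filtration `F` of `N` and the filter `𝔇`. -/
structure IsModelDiamond {κ : Cardinal.{u}} (D : Filter (Below κ)) (P : ForcingNotion.{u})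
    (N : ZFSet.{u}) (F : Ordinal.{u} → ZFSet.{u}) (S : Set (Below κ))
    (A : Below κ → Set P.Cond) : Prop where
  positive : Positive D S
  subset : ∀ δ ∈ S, ∀ p ∈ A δ, p.1 ∈ F δ
  bounded : ∀ δ ∈ S, ∃ r : P.Cond, ∀ p ∈ A δ, r ≤ p
  guess : ∀ X : Set P.Cond, (∀ p ∈ X, p.1 ∈ N) → IsLinked κ P X →
    Positive D {δ | δ ∈ S ∧ {p | p ∈ X ∧ p.1 ∈ F δ} = A δ}

/-- The set `E` is a dense open subset of `P`. -/
structure IsDenseOpen (P : ForcingNotion.{u}) (E : ZFSet.{u}) : Prop where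
  subset : E ⊆ P.carrier
  dense : ∀ p : P.Cond, ∃ r ≤ p, r.1 ∈ E
  isOpen : ∀ p r : P.Cond, r ≤ p → p.1 ∈ E → r.1 ∈ E

/-- `⟨(A δ, q δ) : δ ∈ S⟩` is an `(N, P)`-rule. -/
structure IsRule {κ : Cardinal.{u}} (D : Filter (Below κ)) (P : ForcingNotion.{u})
    (N : ZFSet.{u}) (F : Ordinal.{u} → ZFSet.{u}) (S : Set (Below κ))
    (A : Below κ → Set P.Cond) (q : Below κ → P.Cond) : Prop where
  diamond : IsModelDiamond D P N F S A
  mem : ∀ δ ∈ S, (q δ).1 ∈ N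
  lower : ∀ δ ∈ S, ∀ p ∈ A δ, q δ ≤ p
  generic : ∀ E ∈ N, IsDenseOpen P E → ∃ β : Below κ, ∀ δ ∈ S, β ≤ δ → (q δ).1 ∈ E

/-- The statement `F δ ∩ G = A`, about the generic filter `G`. -/
def fGuesses {P : ForcingNotion.{u}} (Nδ : ZFSet.{u}) (A : Set P.Cond) : P.Cond → Prop :=
  fAll fun p : P.Cond =>
    fIff (fAnd (fGround (p.1 ∈ Nδ)) (fMem p genericName)) (fGround (p ∈ A))

/-- The condition `r` is generic for the rule `⟨(A δ, q δ) : δ ∈ S⟩`: it forces that for some `C`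
in (the normal filter generated by) `𝔇`, for all `δ ∈ S ∩ C`, if `F δ ∩ G = A δ`
then `q δ ∈ G`. -/
def IsRuleGeneric {κ : Cardinal.{u}} (D : Filter (Below κ)) (P : ForcingNotion.{u})
    (F : Ordinal.{u} → ZFSet.{u}) (S : Set (Below κ))
    (A : Below κ → Set P.Cond) (q : Below κ → P.Cond) (r : P.Cond) : Prop :=
  (fEx fun C : SubsetName P.Cond (Below κ) =>
    fAnd (fMemNormalFilter D C)
      (fAll fun δ : Below κ =>
        fImp (fAnd (fGround (δ ∈ S)) (fAnd (fMem δ C) (fGuesses (F δ) (A δ))))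
          (fMem (q δ) genericName))) r

/-- `P` is proper over `𝔇`-diamonds. "For almost every relevant model `N`" means: for all
sufficiently large regular `χ` there is `x ∈ H(χ)` such that it holds for every relevant elementary
submodel `N` of `H(χ)` with `P, x ∈ N`. -/
def ProperOverDiamonds {κ : Cardinal.{u}} (D : Filter (Below κ)) (P : ForcingNotion.{u}) : Prop :=
  ∃ χ₀ : Cardinal.{u}, ∀ χ : Cardinal.{u}, χ₀ ≤ χ → χ.IsRegular →
    ∃ x ∈ Hereditary χ, ∀ N : ZFSet.{u}, IsRelevant κ χ N → P.code ∈ N → x ∈ N →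
      ∀ F : Ordinal.{u} → ZFSet.{u}, IsFiltration κ χ N F →
        ∀ (S : Set (Below κ)) (A : Below κ → Set P.Cond) (q : Below κ → P.Cond),
          IsRule D P N F S A q →
            ∀ p : P.Cond, p.1 ∈ N → ∃ r ≤ p, IsRuleGeneric D P F S A q r

/-! ### The uniformizing forcing -/

/-- The set of ordinals below `ω₂` of cofinality `ω₁`. -/
def cofOmegaOne : Set Ordinal.{u} := {δ | δ < (ℵ_ 2).ord ∧ δ.cof = ℵ_ 1}

/-- `η` is a continuous ladder system on `S`: for `δ ∈ S` the function `η δ` is strictly increasing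
and continuous from `ω₁` onto a cofinal subset of `δ`. -/
def IsContinuousLadderSystem (S : Set Ordinal.{u})
    (η : Ordinal.{u} → Below (ℵ_ 1 : Cardinal.{u}) → Ordinal.{u}) : Prop :=
  ∀ δ ∈ S, Order.IsNormal (η δ) ∧ (∀ i, η δ i < δ) ∧ ∀ β < δ, ∃ i, β ≤ η δ i

/-- The element `0` or `1` of the ordinal `2 = {0, 1}`, as a set. -/
def bitCode (b : Fin 2) : ZFSet.{u} := (((b : ℕ) : Ordinal.{u})).toZFSet

/-- The set `{i ∈ E₀ : p(η_δ(i)) ≠ c_δ(i)}` of errors of the partial function `p` (a set of ordered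
pairs) at `δ`; only those `i` count for which `η_δ(i)` is in the domain of `p`. -/
def errorSet (E₀ : Set (Below (ℵ_ 1 : Cardinal.{u})))
    (η : Ordinal.{u} → Below (ℵ_ 1 : Cardinal.{u}) → Ordinal.{u})
    (c : Ordinal.{u} → Below (ℵ_ 1 : Cardinal.{u}) → Fin 2) (p : ZFSet.{u}) (δ : Ordinal.{u}) :
    Set (Below (ℵ_ 1 : Cardinal.{u})) :=
  {i | i ∈ E₀ ∧ ∃ b : Fin 2, ZFSet.pair (η δ i).toZFSet (bitCode b) ∈ p ∧ b ≠ c δ i}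

/-- The set of conditions: the partial functions `p` from `ω₂` to `2` of size at most `ℵ₁` such that
for each `δ < ω₂` of cofinality `ω₁` the set of errors at `δ` is nonstationary. -/
def uniformizingCarrier (E₀ : Set (Below (ℵ_ 1 : Cardinal.{u})))
    (η : Ordinal.{u} → Below (ℵ_ 1 : Cardinal.{u}) → Ordinal.{u})
    (c : Ordinal.{u} → Below (ℵ_ 1 : Cardinal.{u}) → Fin 2) : ZFSet.{u} :=
  ZFSet.sep
    (fun p => (∀ x y z, ZFSet.pair x y ∈ p → ZFSet.pair x z ∈ p → y = z) ∧
      p.card ≤ ℵ_ 1 ∧ ∀ δ ∈ cofOmegaOne, ¬ IsStationary (errorSet E₀ η c p δ))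
    (ZFSet.powerset (ZFSet.prod (ℵ_ 2 : Cardinal.{u}).ord.toZFSet (2 : Ordinal.{u}).toZFSet))

/-- The uniformizing notion of forcing: the conditions are ordered by `q ≤ p ↔ p ⊆ q`. -/
def uniformizingForcing (E₀ : Set (Below (ℵ_ 1 : Cardinal.{u})))
    (η : Ordinal.{u} → Below (ℵ_ 1 : Cardinal.{u}) → Ordinal.{u})
    (c : Ordinal.{u} → Below (ℵ_ 1 : Cardinal.{u}) → Fin 2) : ForcingNotion.{u} where
  carrier := uniformizingCarrier E₀ η c
  rel := ZFSet.pairSep (fun q p => p ⊆ q) (uniformizingCarrier E₀ η c)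
    (uniformizingCarrier E₀ η c)
  nonempty := by
    refine ⟨∅, ?_⟩
    simp [uniformizingCarrier, errorSet]
  rel_subset := by
    intro z hz
    rw [ZFSet.mem_pairSep] at hz
    obtain ⟨a, ha, b, hb, rfl, -⟩ := hz
    exact ZFSet.pair_mem_prod.2 ⟨ha, hb⟩
  refl := by
    intro p hp
    rw [ZFSet.mem_pairSep]
    exact ⟨p, hp, p, hp, rfl, fun _ h => h⟩
  trans := by
    intro p q r hpq hqr
    rw [ZFSet.mem_pairSep] at *
    obtain ⟨a, ha, b, hb, e₁, h₁⟩ := hpq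
    obtain ⟨a', ha', b', hb', e₂, h₂⟩ := hqr
    obtain ⟨rfl, rfl⟩ := ZFSet.pair_inj.1 e₁
    obtain ⟨rfl, rfl⟩ := ZFSet.pair_inj.1 e₂
    exact ⟨_, ha, _, hb', rfl, fun _ h => h₁ (h₂ h)⟩

end OverDiamonds

end

/-!
Write `P` for the uniformizing forcing, `N` for the given model with its filtration `F`, and
`θ = N ∩ ω₂`.  The generic condition is the union `q` of an increasing sequence `R j`, `j < ω₁`, of
conditions in `N`.  At limit stages one takes unions: `N` is closed under countable sequences, and a
countable union of nonstationary sets is nonstationary, so these unions are conditions in `N`.  The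
two tasks of the construction are carried out at disjoint sets of stages.

* At stages `δ ∈ S ∖ E₀` the sequence is continued with `q_δ` whenever `q_δ` extends everything
  constructed so far.  For `δ` in a club, `R j ∈ F δ` for all `j < δ`.  So if some `s ≤ q` forces
  `F δ ∩ G = A_δ`, then `R j ∈ A_δ` for all `j < δ`, hence `q_δ` does extend everything constructed
  before `δ`, and `q_δ ⊆ q`.  Since `E₀ᶜ` belongs to the filter, this makes `q` generic for the rule
  (`isRuleGeneric_of_forall`).
* At stages `i ∈ E₀` the value `c_θ(i)` is given to `η_θ(i)` unless this ordinal is already in the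
  domain.  For `i` in a club the domain at stage `i` is contained in `η_θ(i)`, so `q` makes no
  error at `i`.  This is why `q` is a condition as far as `δ = θ` is concerned; for `δ < θ` a single
  `R j` is defined on all of `δ`, and for `δ > θ` only countably many points of the ladder lie in
  the domain of `q` (`IsClosedModel.exists_condition`).

That conditions can be extended to be defined below any given ordinal
(`exists_extension_defined_below`) uses that distinct ladders share only countably many points.

Elementarity of `N` is used through a single formula, "the pair `(s, r)` belongs to `x`": it
shows that `N` is closed under every set function that belongs to `N`.  The parameter `x ∈ H(χ)` is
chosen to code the few operations needed in the construction, such as the extension of conditions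
(`exists_closing_parameter`, `exists_parameter_isClosedModel`).
-/

open Cardinal Set

noncomputable section

namespace OverDiamonds

section Models

/-! ### Elementary submodels and set functions -/

open FirstOrder FirstOrder.Language

theorem Hereditary.mem_of_mem {χ : Cardinal.{u}} {x y : ZFSet.{u}} (hx : x ∈ Hereditary χ)
    (hy : y ∈ x) : y ∈ Hereditary χ := by
  obtain ⟨t, ht, hxt, hc⟩ := hx
  exact ⟨t, ht, ht.subset_of_mem (hxt hy), hc⟩

theorem exists_forall_mem_hereditary (x : ZFSet.{u}) :
    ∃ χ₀ : Cardinal.{u}, ∀ χ, χ₀ ≤ χ → x ∈ Hereditary χ :=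
  ⟨Order.succ (ZFSet.vonNeumann x.rank).card, fun _ h =>
    ⟨_, ZFSet.isTransitive_vonNeumann _, ZFSet.subset_vonNeumann_self x,
      (Order.lt_succ _).trans_le h⟩⟩

/-- A definition of the ordered pair by a formula with bounded quantifiers, which is absolute for
the transitive set `H(χ)`. -/
theorem eq_pair_iff {w s r : ZFSet.{u}} : w = ZFSet.pair s r ↔
    ∃ a ∈ w, ∃ b ∈ w, (∀ z ∈ w, z = a ∨ z = b) ∧ (s ∈ a ∧ ∀ z ∈ a, z = s) ∧
      (s ∈ b ∧ r ∈ b ∧ ∀ z ∈ b, z = s ∨ z = r) := by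
  constructor
  · rintro rfl
    exact ⟨{s}, by simp [ZFSet.pair], {s, r}, by simp [ZFSet.pair], by simp [ZFSet.pair],
      by simp, by simp⟩
  · rintro ⟨a, ha, b, hb, hw, ⟨hsa, ha'⟩, hsb, hrb, hb'⟩
    have ea : a = {s} := by
      ext z
      rw [ZFSet.mem_singleton]
      exact ⟨ha' z, by rintro rfl; exact hsa⟩
    have eb : b = {s, r} := by
      ext z
      rw [ZFSet.mem_pair]
      exact ⟨hb' z, by rintro (rfl | rfl) <;> assumption⟩
    subst ea eb
    ext z
    rw [ZFSet.pair, ZFSet.mem_pair]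
    exact ⟨hw z, by rintro (rfl | rfl) <;> assumption⟩

/-- The atomic formula `t₁ ∈ t₂`. -/
def memFormula {α : Type*} {n : ℕ} (t₁ t₂ : setLanguage.Term (α ⊕ Fin n)) :
    setLanguage.BoundedFormula α n :=
  Relations.boundedFormula₂ (L := setLanguage) SetRel.mem t₁ t₂

theorem realize_memFormula {H : Set ZFSet.{u}} {α : Type*} {n : ℕ}
    {t₁ t₂ : setLanguage.Term (α ⊕ Fin n)} {v : α → H} {xs : Fin n → H} :
    (memFormula t₁ t₂).Realize v xs ↔
      (t₁.realize (Sum.elim v xs)).1 ∈ (t₂.realize (Sum.elim v xs)).1 :=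
  BoundedFormula.realize_rel₂.trans Iff.rfl

/-- An elementary submodel is closed under the set functions that it contains: if `x, s ∈ N`
and `x` relates `s` to something, then `x` relates `s` to an element of `N`. -/
theorem IsElementarySubmodel.exists_pair_mem {χ : Cardinal.{u}} {N x s : ZFSet.{u}}
    (hN : IsElementarySubmodel χ N) (hx : x ∈ N) (hs : s ∈ N) (h : ∃ r, ZFSet.pair s r ∈ x) :
    ∃ r ∈ N, ZFSet.pair s r ∈ x := by
  obtain ⟨M, hM⟩ := hN
  obtain ⟨hxH, hxM⟩ := (hM x).1 hx
  obtain ⟨hsH, hsM⟩ := (hM s).1 hs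
  let A : Set (Hereditary χ) := (M : Set (Hereditary χ))
  let D : Set (Hereditary χ) := {r | ZFSet.pair s r.1 ∈ x}
  have hne : D.Nonempty := by
    obtain ⟨r, hr⟩ := h
    have h₁ := Hereditary.mem_of_mem hxH hr
    have h₂ : ({s, r} : ZFSet) ∈ Hereditary χ :=
      Hereditary.mem_of_mem h₁ (by simp [ZFSet.pair])
    exact ⟨⟨r, Hereditary.mem_of_mem h₂ (by simp)⟩, hr⟩
  have hdef : A.Definable₁ setLanguage D := by
    rw [Set.Definable₁, Set.definable_iff_exists_formula_sum]
    let cx : ∀ n : ℕ, setLanguage.Term ((A ⊕ Fin 1) ⊕ Fin n) :=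
      fun n => Term.var (Sum.inl (Sum.inl ⟨⟨x, hxH⟩, hxM⟩))
    let cs : ∀ n : ℕ, setLanguage.Term ((A ⊕ Fin 1) ⊕ Fin n) :=
      fun n => Term.var (Sum.inl (Sum.inl ⟨⟨s, hsH⟩, hsM⟩))
    let cr : ∀ n : ℕ, setLanguage.Term ((A ⊕ Fin 1) ⊕ Fin n) :=
      fun n => Term.var (Sum.inl (Sum.inr 0))
    let b : ∀ {n : ℕ}, Fin n → setLanguage.Term ((A ⊕ Fin 1) ⊕ Fin n) :=
      fun i => Term.var (Sum.inr i)
    -- the bound variables are `w`, the two elements of `w`, and a variable for bounded quantifiers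
    refine ⟨∃' ∃' ∃' (memFormula (b 0) (cx 3) ⊓ (memFormula (b 1) (b 0) ⊓ (memFormula (b 2) (b 0) ⊓
      (∀' (memFormula (b 3) (b 0) ⟹ (((b 3).bdEqual (b 1)) ⊔ ((b 3).bdEqual (b 2)))) ⊓
      ((memFormula (cs 3) (b 1) ⊓ ∀' (memFormula (b 3) (b 1) ⟹ (b 3).bdEqual (cs 4))) ⊓
      (memFormula (cs 3) (b 2) ⊓ (memFormula (cr 3) (b 2) ⊓
        ∀' (memFormula (b 3) (b 2) ⟹ (((b 3).bdEqual (cs 4)) ⊔ ((b 3).bdEqual (cr 4)))))))))))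
      , ?_⟩
    ext v
    simp only [Formula.Realize, BoundedFormula.realize_ex, BoundedFormula.realize_inf,
      BoundedFormula.realize_all, BoundedFormula.realize_imp, BoundedFormula.realize_sup,
      realize_memFormula, BoundedFormula.realize_bdEqual, Term.realize_var, cx, cs,
      cr, b, Sum.elim_inl, Sum.elim_inr, Set.mem_ofPred_eq]
    simp only [Fin.snoc, D, Set.mem_ofPred_eq]
    simp [Subtype.ext_iff]
    constructor
    · intro hp
      obtain ⟨a, ha, b, hb, hw⟩ := eq_pair_iff.1 (rfl : ZFSet.pair s (v 0).1 = _)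
      have hH := Hereditary.mem_of_mem hxH hp
      have haH := Hereditary.mem_of_mem hH ha
      have hbH := Hereditary.mem_of_mem hH hb
      exact ⟨_, hp, hH, a, ha, haH, b, hb, by grind⟩
    · rintro ⟨w, hwx, hw, a, ha, haH, b, hb, h₁, ⟨h₂, h₃⟩, h₄, h₅, hbH, h₆⟩
      rw [← eq_pair_iff.2 ⟨a, ha, b, hb, fun z hz => h₁ z (Hereditary.mem_of_mem hw hz) hz,
        ⟨h₂, fun z hz => h₃ z (Hereditary.mem_of_mem haH hz) hz⟩, h₄, h₅,
        fun z hz => h₆ z (Hereditary.mem_of_mem hbH hz) hz⟩]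
      exact hwx
  obtain ⟨r, hrD, hrM⟩ := M.meetsDefinable D hne hdef
  exact ⟨r.1, (hM _).2 ⟨r.2, hrM⟩, hrD⟩

/-! ### Closing a model under prescribed operations -/

/-- The restriction of the class function `f` to the set `Y`, as a set of ordered pairs. -/
def graphOn (f : ZFSet.{u} → ZFSet.{u}) (Y : ZFSet.{u}) : ZFSet.{u} :=
  ZFSet.range fun y : Y => ZFSet.pair y (f y)

theorem pair_mem_graphOn {f : ZFSet.{u} → ZFSet.{u}} {Y s r : ZFSet.{u}} :
    ZFSet.pair s r ∈ graphOn f Y ↔ s ∈ Y ∧ f s = r := by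
  simp only [graphOn, ZFSet.mem_range, ZFSet.pair_inj]
  constructor
  · rintro ⟨y, rfl, rfl⟩
    exact ⟨y.2, rfl⟩
  · rintro ⟨h, rfl⟩
    exact ⟨⟨s, h⟩, rfl, rfl⟩

theorem IsElementarySubmodel.apply_mem {χ : Cardinal.{u}} {N Y s : ZFSet.{u}}
    {f : ZFSet.{u} → ZFSet.{u}} (hN : IsElementarySubmodel χ N) (hf : graphOn f Y ∈ N)
    (hs : s ∈ N) (hsY : s ∈ Y) : f s ∈ N := by
  obtain ⟨r, hr, h⟩ := hN.exists_pair_mem hf hs ⟨f s, pair_mem_graphOn.2 ⟨hsY, rfl⟩⟩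
  rwa [(pair_mem_graphOn.1 h).2]

/-- The range of a set of ordered pairs. -/
def pairRange (s : ZFSet.{u}) : ZFSet.{u} :=
  ZFSet.sep (fun y => ∃ a, ZFSet.pair a y ∈ s) (ZFSet.sUnion (ZFSet.sUnion s))

theorem mem_pairRange {s y : ZFSet.{u}} : y ∈ pairRange s ↔ ∃ a, ZFSet.pair a y ∈ s := by
  rw [pairRange, ZFSet.mem_sep, and_iff_right_iff_imp]
  rintro ⟨a, h⟩
  exact ZFSet.mem_sUnion_of_mem (z := ({a, y} : ZFSet)) (ZFSet.mem_pair.2 (Or.inr rfl))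
    (ZFSet.mem_sUnion_of_mem (z := ZFSet.pair a y) (by simp [ZFSet.pair]) h)

theorem mem_seqCode {α : Ordinal.{u}} {f : Ordinal.{u} → ZFSet.{u}} {z : ZFSet.{u}} :
    z ∈ seqCode α f ↔ ∃ β < α, ZFSet.pair β.toZFSet (f β) = z := by
  simp [seqCode]

theorem mem_pairRange_seqCode {α : Ordinal.{u}} {f : Ordinal.{u} → ZFSet.{u}} {y : ZFSet.{u}} :
    y ∈ pairRange (seqCode α f) ↔ ∃ β < α, f β = y := by
  simp only [mem_pairRange, mem_seqCode, ZFSet.pair_inj]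
  constructor
  · rintro ⟨_, β, hβ, -, h⟩
    exact ⟨β, hβ, h⟩
  · rintro ⟨β, hβ, h⟩
    exact ⟨_, β, hβ, rfl, h⟩

theorem pairRange_seqCode_toZFSet (α : Ordinal.{u}) :
    pairRange (seqCode α Ordinal.toZFSet) = α.toZFSet := by
  ext y
  rw [mem_pairRange_seqCode, Ordinal.mem_toZFSet_iff]

theorem seqCode_subset_prod {α β : Ordinal.{u}} {f : Ordinal.{u} → ZFSet.{u}} {Y : ZFSet.{u}}
    (hα : α ≤ β) (hf : ∀ γ < α, f γ ∈ Y) : seqCode α f ⊆ ZFSet.prod β.toZFSet Y := by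
  intro z hz
  obtain ⟨γ, hγ, rfl⟩ := mem_seqCode.1 hz
  exact ZFSet.pair_mem_prod.2 ⟨Ordinal.toZFSet_mem_toZFSet_iff.2 (hγ.trans_le hα), hf γ hγ⟩

/-- Countably many operations on sets can be coded by one set `x`, in such a way that every relevant
model containing `x` is closed under all of them. The number `n` serves as the name of the `n`th
operation; the first operation recorded in `x` is the one that brings the countable ordinals into
the model. -/
theorem exists_closing_parameter (f : ℕ → ZFSet.{u} → ZFSet.{u}) (Y : ℕ → ZFSet.{u}) :
    ∃ x : ZFSet.{u}, ∀ χ N, IsRelevant (ℵ_ 1) χ N → x ∈ N →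
      (∀ i < (ℵ_ 1 : Cardinal.{u}).ord, i.toZFSet ∈ N) ∧
      ∀ n, ∀ s ∈ N, s ∈ Y n → f n s ∈ N := by
  let W : ZFSet.{u} := (ℵ_ 1 : Cardinal.{u}).ord.toZFSet
  let g : ℕ → ZFSet.{u} := fun n => Nat.rec (graphOn pairRange (ZFSet.powerset (ZFSet.prod W W)))
    (fun n _ => graphOn (f n) (Y n)) n
  -- the first operation has the name `0`, which is `∅` and so needs no earlier closure of `N`
  let x : ZFSet.{u} := ZFSet.range fun n : ℕ => ZFSet.pair (n : Ordinal.{u}).toZFSet (g n)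
  have hx : ∀ (n : ℕ) (r : ZFSet.{u}),
      ZFSet.pair (n : Ordinal.{u}).toZFSet r ∈ x ↔ g n = r := by
    intro n r
    simp only [x, ZFSet.mem_range, ZFSet.pair_inj, Ordinal.toZFSet_injective.eq_iff, Nat.cast_inj]
    simp
  refine ⟨x, fun χ N hN hxN => ?_⟩
  have hg : ∀ n : ℕ, (n : Ordinal.{u}).toZFSet ∈ N → g n ∈ N := by
    intro n hn
    obtain ⟨r, hr, h⟩ := hN.elementary.exists_pair_mem hxN hn ⟨g n, (hx n _).2 rfl⟩
    rwa [(hx n r).1 h]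
  have hω₁ : 0 < (ℵ_ 1 : Cardinal.{u}).ord :=
    Cardinal.ord_pos.2 (Cardinal.aleph0_pos.trans_le (Cardinal.aleph0_le_aleph 1))
  have h0 : g 0 ∈ N := by
    have h := hN.closed 0 hω₁ (fun _ => ∅) (by simp)
    have e : seqCode 0 (fun _ => ∅) = (((0 : ℕ) : Ordinal.{u})).toZFSet := by
      ext z
      simp [mem_seqCode]
    exact hg 0 (e ▸ h)
  -- `i` is the range of the identity sequence on `i`, which is in `N` once all `j < i` are
  have hord : ∀ i : Ordinal.{u}, i < (ℵ_ 1 : Cardinal.{u}).ord → i.toZFSet ∈ N := by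
    intro i
    induction i using WellFoundedLT.induction with
    | ind i ih =>
      intro hi
      have h := hN.closed i hi Ordinal.toZFSet fun β hβ => ih β hβ (hβ.trans hi)
      rw [← pairRange_seqCode_toZFSet]
      refine hN.elementary.apply_mem h0 h (ZFSet.mem_powerset.2 (seqCode_subset_prod hi.le ?_))
      exact fun γ hγ => Ordinal.toZFSet_mem_toZFSet_iff.2 (hγ.trans hi)
  refine ⟨hord, fun n s hs hsY => hN.elementary.apply_mem (hg (n + 1) (hord _ ?_)) hs hsY⟩
  exact (Ordinal.natCast_lt_omega0 _).trans_le
    (by rw [← Cardinal.ord_aleph0]; exact Cardinal.ord_le_ord.2 (Cardinal.aleph0_le_aleph 1))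

/-- A countable set of elements of a relevant model is the range of a sequence in the model. -/
theorem IsRelevant.exists_seqCode_mem {χ : Cardinal.{u}} {N : ZFSet.{u}}
    (hN : IsRelevant (ℵ_ 1) χ N) {Y : Set ZFSet.{u}} (hY : Y.Countable) (hne : Y.Nonempty)
    (hYN : ∀ y ∈ Y, y ∈ N) :
    ∃ f : Ordinal.{u} → ZFSet.{u}, seqCode Ordinal.omega0 f ∈ N ∧
      ∀ y, y ∈ Y ↔ ∃ β < Ordinal.omega0, f β = y := by
  obtain ⟨f, rfl⟩ := hY.exists_eq_range hne
  let g : Ordinal.{u} → ZFSet.{u} := Function.extend Nat.cast f fun _ => ∅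
  have hg : ∀ n : ℕ, g n = f n := fun n => Nat.cast_injective.extend_apply f _ n
  refine ⟨g, hN.closed _ ?_ g ?_, fun y => ⟨?_, ?_⟩⟩
  · rw [← Cardinal.ord_aleph0]
    exact Cardinal.ord_lt_ord.2 (Cardinal.aleph0_lt_aleph_one)
  · intro β hβ
    obtain ⟨n, rfl⟩ := Ordinal.lt_omega0.1 hβ
    rw [hg]
    exact hYN _ ⟨n, rfl⟩
  · rintro ⟨n, rfl⟩
    exact ⟨n, Ordinal.natCast_lt_omega0 n, hg n⟩
  · rintro ⟨β, hβ, rfl⟩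
    obtain ⟨n, rfl⟩ := Ordinal.lt_omega0.1 hβ
    exact ⟨n, (hg n).symm⟩

end Models

/-! ### Countable ordinals and ordinals below `ω₂` -/

theorem aleph0_lt_cof_below : ℵ₀ < Order.cof (Below (ℵ_ 1 : Cardinal.{u})) := by
  rw [show Order.cof (Below (ℵ_ 1 : Cardinal.{u})) = _ from Ordinal.cof_Iio _,
    ← Ordinal.lift_cof, isRegular_aleph_one.cof_ord]
  simp

theorem cof_below_ne : Order.cof (Below (ℵ_ 1 : Cardinal.{u})) ≠ ℵ₀ := aleph0_lt_cof_below.ne'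

theorem countable_Iio_below (i : Below (ℵ_ 1 : Cardinal.{u})) : (Iio i).Countable := by
  have h : #(Iio i.1) ≤ ℵ₀ := by
    rw [Cardinal.mk_Iio_ordinal, Cardinal.lift_le_aleph0, ← Order.lt_succ_iff, succ_aleph0]
    exact Cardinal.lt_ord.1 i.2
  have := Cardinal.le_aleph0_iff_set_countable.1 h
  exact this.preimage_of_injOn (f := Subtype.val) Subtype.val_injective.injOn

theorem exists_gt_of_countable {s : Set (Below (ℵ_ 1 : Cardinal.{u}))} (hs : s.Countable) :
    ∃ b, ∀ i ∈ s, i < b := by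
  by_contra! h
  exact (Order.cof_le h).not_gt
    ((Cardinal.le_aleph0_iff_set_countable.2 hs).trans_lt aleph0_lt_cof_below)

theorem not_isStationary_of_countable {s : Set (Below (ℵ_ 1 : Cardinal.{u}))} (hs : s.Countable) :
    ¬ IsStationary s := by
  obtain ⟨b, hb⟩ := exists_gt_of_countable hs
  rw [not_isStationary_iff]
  refine ⟨Ici b, ⟨?_, fun a => ⟨max a b, Set.mem_Ici.2 (le_max_right _ _), le_max_left _ _⟩⟩, ?_⟩
  · intro d hd hne _ a ha
    obtain ⟨x, hx⟩ := hne
    exact (hd hx : b ≤ x).trans (ha.1 hx)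
  · exact Set.disjoint_left.2 fun i hi hbi => (hb i hi).not_ge hbi

/-- The limit ordinals closed under a function on `ω₁` form a club. -/
theorem isClub_setOf_closed (h : Below (ℵ_ 1 : Cardinal.{u}) → Below (ℵ_ 1 : Cardinal.{u})) :
    IsClub {δ : Below (ℵ_ 1 : Cardinal.{u}) | Order.IsSuccLimit δ.1 ∧ ∀ j < δ, h j < δ} := by
  constructor
  · intro d hd hne _ a ha
    have key : ∀ j < a, ∃ x ∈ d, j < x := fun j hj => (lt_isLUB_iff ha).1 hj
    constructor
    · rw [Ordinal.isSuccLimit_iff]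
      obtain ⟨x, hx⟩ := hne
      refine ⟨((pos_iff_ne_zero.2 (Ordinal.isSuccLimit_iff.1 (hd hx).1).1).trans_le
        (show x.1 ≤ a.1 from ha.1 hx)).ne', ?_⟩
      refine Order.isSuccPrelimit_of_succ_lt fun j hj => ?_
      obtain ⟨y, hy, hjy⟩ := key ⟨j, hj.trans a.2⟩ hj
      exact ((hd hy).1.succ_lt hjy).trans_le (ha.1 hy)
    · intro j hj
      obtain ⟨y, hy, hjy⟩ := key j hj
      exact ((hd hy).2 j hjy).trans_le (ha.1 hy)
  · intro a
    have hstep : ∀ b : Below (ℵ_ 1 : Cardinal.{u}), ∃ b', b < b' ∧ ∀ j ≤ b, h j < b' := by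
      intro b
      have hc : (insert b (h '' insert b (Iio b))).Countable :=
        (((countable_Iio_below b).insert b).image h).insert b
      obtain ⟨b', hb'⟩ := exists_gt_of_countable hc
      refine ⟨b', hb' b (mem_insert _ _), fun j hj => hb' _ (mem_insert_of_mem _ ⟨j, ?_, rfl⟩)⟩
      rcases hj.eq_or_lt with rfl | hj
      · exact mem_insert _ _
      · exact mem_insert_of_mem _ hj
    choose g hg₁ hg₂ using hstep
    let s : ℕ → Below (ℵ_ 1 : Cardinal.{u}) := fun n => g^[n] a
    have hs : ∀ n, s (n + 1) = g (s n) := fun n => Function.iterate_succ_apply' g n a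
    obtain ⟨b, hb⟩ := exists_gt_of_countable (countable_range s)
    let U : Set (Below (ℵ_ 1 : Cardinal.{u})) := {b | ∀ n, s n < b}
    have hU : U.Nonempty := ⟨b, fun n => hb _ ⟨n, rfl⟩⟩
    let δ := wellFounded_lt.min U hU
    have hδ : ∀ n, s n < δ := wellFounded_lt.min_mem U hU
    have hδ' : ∀ j < δ, ∃ n, j ≤ s n := by
      intro j hj
      by_contra! hcon
      exact wellFounded_lt.not_lt_min U hcon hj
    refine ⟨δ, ⟨?_, ?_⟩, (hδ 0).le⟩
    · rw [Ordinal.isSuccLimit_iff]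
      refine ⟨(zero_le.trans_lt (show (s 0).1 < δ.1 from hδ 0)).ne', ?_⟩
      refine Order.isSuccPrelimit_of_succ_lt fun j hj => ?_
      obtain ⟨n, hn⟩ := hδ' ⟨j, hj.trans δ.2⟩ hj
      refine lt_of_le_of_lt (Order.succ_le_of_lt ?_) (show (s (n + 1)).1 < δ.1 from hδ (n + 1))
      refine lt_of_le_of_lt (show j ≤ (s n).1 from hn) ?_
      rw [hs]
      exact hg₁ (s n)
    · intro j hj
      obtain ⟨n, hn⟩ := hδ' j hj
      exact (hg₂ (s n) j hn).trans (by rw [← hs]; exact hδ (n + 1))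

theorem mk_below (κ : Cardinal.{u}) : #(Below κ) = Cardinal.lift.{u + 1} κ := by
  rw [show #(Below κ) = _ from Cardinal.mk_Iio_ordinal _, Cardinal.card_ord]

theorem lt_omega_two_iff {ξ : Ordinal.{u}} :
    ξ < (ℵ_ 2 : Cardinal.{u}).ord ↔ #(Iio ξ) ≤ #(Below (ℵ_ 1 : Cardinal.{u})) := by
  rw [Cardinal.lt_ord, ← one_add_one_eq_two, ← Cardinal.succ_aleph, Order.lt_succ_iff,
    Cardinal.mk_Iio_ordinal, mk_below, Cardinal.lift_le]

/-- A set of at most `ℵ₁` ordinals below `ω₂` is bounded below `ω₂`. -/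
theorem exists_lt_omega_two {s : Set Ordinal.{u}} (hs : #s ≤ #(Below (ℵ_ 1 : Cardinal.{u})))
    (h : ∀ ξ ∈ s, ξ < (ℵ_ 2 : Cardinal.{u}).ord) :
    ∃ β < (ℵ_ 2 : Cardinal.{u}).ord, ∀ ξ ∈ s, ξ < β := by
  have hreg : (ℵ_ 2 : Cardinal.{u}).IsRegular := by
    rw [← one_add_one_eq_two]
    exact isRegular_aleph_add_one 1
  by_contra! hcon
  have hcof : IsCofinal {ξ : Below (ℵ_ 2 : Cardinal.{u}) | ξ.1 ∈ s} := by
    intro β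
    obtain ⟨ξ, hξ, hβ⟩ := hcon β.1 β.2
    exact ⟨⟨ξ, h ξ hξ⟩, hξ, hβ⟩
  have h₁ := Order.cof_le hcof
  rw [show Order.cof (Below (ℵ_ 2 : Cardinal.{u})) = _ from Ordinal.cof_Iio _,
    ← Ordinal.lift_cof, hreg.cof_ord] at h₁
  have h₂ : #{ξ : Below (ℵ_ 2 : Cardinal.{u}) | ξ.1 ∈ s} ≤ #s :=
    Cardinal.mk_le_of_injective (f := fun ξ => (⟨ξ.1.1, ξ.2⟩ : s)) fun a b hab =>
      Subtype.ext (Subtype.ext (congrArg (fun z : s => z.1) hab))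
  have h₃ := h₁.trans (h₂.trans hs)
  rw [mk_below, Cardinal.lift_le, Cardinal.aleph_le_aleph] at h₃
  exact absurd h₃ (by simp)

theorem succ_lt_omega_two {ξ : Ordinal.{u}} (hξ : ξ < (ℵ_ 2 : Cardinal.{u}).ord) :
    Order.succ ξ < (ℵ_ 2 : Cardinal.{u}).ord :=
  (Cardinal.isSuccLimit_ord (Cardinal.aleph0_le_aleph 2)).succ_lt hξ

theorem card_le_aleph_one_iff {p : ZFSet.{u}} :
    p.card ≤ ℵ_ 1 ↔ #p ≤ #(Below (ℵ_ 1 : Cardinal.{u})) := by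
  rw [ZFSet.cardinalMk_coe_sort, mk_below, Cardinal.lift_le]

/-! ### Conditions of the uniformizing forcing -/

/-- The set `p` of ordered pairs, as a partial function, has the value `b` at the ordinal `ξ`. -/
def HasValue (p : ZFSet.{u}) (ξ : Ordinal.{u}) (b : Fin 2) : Prop :=
  ZFSet.pair ξ.toZFSet (bitCode b) ∈ p

theorem bitCode_injective : Function.Injective bitCode.{u} := by
  intro a b h
  have := Ordinal.toZFSet_injective h
  exact Fin.ext (by exact_mod_cast this)

theorem pair_toZFSet_bitCode_inj {ξ ζ : Ordinal.{u}} {a b : Fin 2} :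
    ZFSet.pair ξ.toZFSet (bitCode a) = ZFSet.pair ζ.toZFSet (bitCode b) ↔ ξ = ζ ∧ a = b := by
  rw [ZFSet.pair_inj, Ordinal.toZFSet_injective.eq_iff, bitCode_injective.eq_iff]

theorem mem_prod_two_iff {κ : Ordinal.{u}} {z : ZFSet.{u}} :
    z ∈ ZFSet.prod κ.toZFSet (2 : Ordinal.{u}).toZFSet ↔
      ∃ ξ < κ, ∃ b : Fin 2, z = ZFSet.pair ξ.toZFSet (bitCode b) := by
  rw [ZFSet.mem_prod]
  constructor
  · rintro ⟨x, hx, y, hy, rfl⟩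
    obtain ⟨ξ, hξ, rfl⟩ := Ordinal.mem_toZFSet_iff.1 hx
    obtain ⟨n, hn, rfl⟩ := Ordinal.mem_toZFSet_iff.1 hy
    obtain ⟨m, rfl⟩ := Ordinal.lt_omega0.1
      (hn.trans (by exact_mod_cast Ordinal.natCast_lt_omega0 2))
    exact ⟨ξ, hξ, ⟨m, by exact_mod_cast hn⟩, rfl⟩
  · rintro ⟨ξ, hξ, b, rfl⟩
    exact ⟨_, Ordinal.toZFSet_mem_toZFSet_iff.2 hξ, _,
      Ordinal.toZFSet_mem_toZFSet_iff.2 (by exact_mod_cast b.2), rfl⟩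

variable {E₀ : Set (Below (ℵ_ 1 : Cardinal.{u}))}
  {η : Ordinal.{u} → Below (ℵ_ 1 : Cardinal.{u}) → Ordinal.{u}}
  {c : Ordinal.{u} → Below (ℵ_ 1 : Cardinal.{u}) → Fin 2}

/-- For a partial function from `ω₂` to `2`, to have size at most `ℵ₁` is to have a domain bounded
below `ω₂`. -/
theorem mem_uniformizingCarrier_iff {p : ZFSet.{u}} : p ∈ uniformizingCarrier E₀ η c ↔
    p ⊆ ZFSet.prod (ℵ_ 2 : Cardinal.{u}).ord.toZFSet (2 : Ordinal.{u}).toZFSet ∧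
      (∀ ξ a b, HasValue p ξ a → HasValue p ξ b → a = b) ∧
      (∃ β < (ℵ_ 2 : Cardinal.{u}).ord, ∀ ξ b, HasValue p ξ b → ξ < β) ∧
      ∀ δ ∈ cofOmegaOne, ¬ IsStationary (errorSet E₀ η c p δ) := by
  rw [uniformizingCarrier, ZFSet.mem_sep, ZFSet.mem_powerset, card_le_aleph_one_iff]
  refine and_congr_right fun hp => ?_
  have hval : ∀ z ∈ p, ∃ ξ < (ℵ_ 2 : Cardinal.{u}).ord, ∃ b : Fin 2,
      z = ZFSet.pair ξ.toZFSet (bitCode b) := fun z hz => mem_prod_two_iff.1 (hp hz)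
  have hfun : (∀ x y z, ZFSet.pair x y ∈ p → ZFSet.pair x z ∈ p → y = z) ↔
      ∀ ξ a b, HasValue p ξ a → HasValue p ξ b → a = b := by
    constructor
    · exact fun h ξ a b ha hb => bitCode_injective (h _ _ _ ha hb)
    · intro h x y z hy hz
      obtain ⟨ξ, -, a, ha⟩ := hval _ hy
      obtain ⟨ζ, -, b, hb⟩ := hval _ hz
      obtain ⟨rfl, rfl⟩ := ZFSet.pair_inj.1 ha
      obtain ⟨e, rfl⟩ := ZFSet.pair_inj.1 hb
      obtain rfl := Ordinal.toZFSet_injective e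
      rw [h ξ a b hy hz]
  rw [hfun]
  refine and_congr_right fun hf => and_congr_left fun _ => ?_
  choose! d hd v hv using hval
  constructor
  · intro hc
    have hs : #(d '' (p : Set ZFSet.{u})) ≤ #(Below (ℵ_ 1 : Cardinal.{u})) :=
      Cardinal.mk_image_le.trans hc
    obtain ⟨β, hβ, h⟩ := exists_lt_omega_two hs (by
      rintro _ ⟨z, hz, rfl⟩
      exact hd z hz)
    refine ⟨β, hβ, fun ξ b hξ => h ξ ⟨_, hξ, ?_⟩⟩
    exact (pair_toZFSet_bitCode_inj.1 (hv _ hξ)).1.symm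
  · rintro ⟨β, hβ, h⟩
    refine le_trans ?_ (lt_omega_two_iff.1 hβ)
    have hval' : ∀ z ∈ p, HasValue p (d z) (v z) := fun z hz => by
      rw [HasValue, ← hv z hz]
      exact hz
    refine Cardinal.mk_le_of_injective
      (f := fun z : p => (⟨d z, h _ _ (hval' z z.2)⟩ : Iio β)) fun z w hzw => ?_
    have e : d z = d w := congrArg Subtype.val hzw
    refine Subtype.ext ((hv z z.2).trans ?_)
    rw [hv w w.2, e, hf (d w) (v z) (v w) (e ▸ hval' z z.2) (hval' w w.2)]

/-- The relation `R` between ordinals below `ω₂` and bits, as a set of ordered pairs. -/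
def ofGraph (R : Ordinal.{u} → Fin 2 → Prop) : ZFSet.{u} :=
  ZFSet.sep (fun z => ∃ ξ b, z = ZFSet.pair ξ.toZFSet (bitCode b) ∧ R ξ b)
    (ZFSet.prod (ℵ_ 2 : Cardinal.{u}).ord.toZFSet (2 : Ordinal.{u}).toZFSet)

theorem hasValue_union_ofGraph {p : ZFSet.{u}} {R : Ordinal.{u} → Fin 2 → Prop} {ξ : Ordinal.{u}}
    {b : Fin 2} : HasValue (p ∪ ofGraph R) ξ b ↔
      HasValue p ξ b ∨ (ξ < (ℵ_ 2 : Cardinal.{u}).ord ∧ R ξ b) := by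
  rw [HasValue, ZFSet.mem_union, ofGraph, ZFSet.mem_sep, mem_prod_two_iff]
  refine or_congr Iff.rfl (and_congr ?_ ?_)
  · constructor
    · rintro ⟨ζ, hζ, a, h⟩
      rwa [(pair_toZFSet_bitCode_inj.1 h).1]
    · exact fun h => ⟨ξ, h, b, rfl⟩
  · constructor
    · rintro ⟨ζ, a, h, hR⟩
      obtain ⟨rfl, rfl⟩ := pair_toZFSet_bitCode_inj.1 h
      exact hR
    · exact fun h => ⟨ξ, b, rfl, h⟩

/-- A condition can be enlarged by a bounded partial function with disjoint domain that makes only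
countably many errors at each `δ`. -/
theorem union_ofGraph_mem {p : ZFSet.{u}} (hp : p ∈ uniformizingCarrier E₀ η c)
    {R : Ordinal.{u} → Fin 2 → Prop} {β : Ordinal.{u}} (hβ : β < (ℵ_ 2 : Cardinal.{u}).ord)
    (hRβ : ∀ ξ b, R ξ b → ξ < β) (hR : ∀ ξ a b, R ξ a → R ξ b → a = b)
    (hdisj : ∀ ξ a b, R ξ a → ¬ HasValue p ξ b)
    (herr : ∀ δ ∈ cofOmegaOne, {i | ∃ b, R (η δ i) b ∧ b ≠ c δ i}.Countable) :
    p ∪ ofGraph R ∈ uniformizingCarrier E₀ η c := by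
  obtain ⟨h₁, h₂, ⟨γ, hγ, h₃⟩, h₄⟩ := mem_uniformizingCarrier_iff.1 hp
  refine mem_uniformizingCarrier_iff.2 ⟨?_, ?_, ⟨max γ β, max_lt hγ hβ, ?_⟩, ?_⟩
  · intro z hz
    rcases ZFSet.mem_union.1 hz with hz | hz
    · exact h₁ hz
    · exact (ZFSet.mem_sep.1 hz).1
  · intro ξ a b ha hb
    rcases hasValue_union_ofGraph.1 ha with ha | ⟨-, ha⟩ <;>
      rcases hasValue_union_ofGraph.1 hb with hb | ⟨-, hb⟩
    · exact h₂ ξ a b ha hb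
    · exact absurd ha (hdisj ξ b a hb)
    · exact absurd hb (hdisj ξ a b ha)
    · exact hR ξ a b ha hb
  · intro ξ b hb
    rcases hasValue_union_ofGraph.1 hb with hb | ⟨-, hb⟩
    · exact lt_max_of_lt_left (h₃ ξ b hb)
    · exact lt_max_of_lt_right (hRβ ξ b hb)
  · intro δ hδ hst
    have hsub : errorSet E₀ η c (p ∪ ofGraph R) δ ⊆
        errorSet E₀ η c p δ ∪ {i | ∃ b, R (η δ i) b ∧ b ≠ c δ i} := by
      rintro i ⟨hi, b, hb, hne⟩
      rcases hasValue_union_ofGraph.1 hb with hb | ⟨-, hb⟩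
      · exact Or.inl ⟨hi, b, hb, hne⟩
      · exact Or.inr ⟨b, hb, hne⟩
    rcases (isStationary_union_iff cof_below_ne).1 (hst.mono hsub) with h | h
    · exact h₄ δ hδ h
    · exact not_isStationary_of_countable (herr δ hδ) h

/-- The union of a nonempty countable chain of conditions is a condition. -/
theorem mem_uniformizingCarrier_of_countable_chain {Y : Set ZFSet.{u}} (hY : Y.Countable)
    (hYP : ∀ y ∈ Y, y ∈ uniformizingCarrier E₀ η c) (hchain : IsChain (· ⊆ ·) Y) {u : ZFSet.{u}}
    (hu : ∀ z, z ∈ u ↔ ∃ y ∈ Y, z ∈ y) : u ∈ uniformizingCarrier E₀ η c := by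
  have hP := fun y hy => mem_uniformizingCarrier_iff.1 (hYP y hy)
  choose! β hβ hβ' using fun y hy => (hP y hy).2.2.1
  refine mem_uniformizingCarrier_iff.2 ⟨?_, ?_, ?_, ?_⟩
  · intro z hz
    obtain ⟨y, hy, hz⟩ := (hu z).1 hz
    exact (hP y hy).1 hz
  · intro ξ a b ha hb
    obtain ⟨y, hy, ha⟩ := (hu _).1 ha
    obtain ⟨y', hy', hb⟩ := (hu _).1 hb
    rcases hchain.total hy hy' with h | h
    · exact (hP y' hy').2.1 ξ a b (h ha) hb
    · exact (hP y hy).2.1 ξ a b ha (h hb)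
  · obtain ⟨γ, hγ, h⟩ := exists_lt_omega_two (s := β '' Y)
      ((Cardinal.le_aleph0_iff_set_countable.2 (hY.image β)).trans
        (by rw [mk_below, Cardinal.aleph0_le_lift]; exact Cardinal.aleph0_le_aleph 1))
      (by rintro _ ⟨y, hy, rfl⟩; exact hβ y hy)
    refine ⟨γ, hγ, fun ξ b hb => ?_⟩
    obtain ⟨y, hy, hb⟩ := (hu _).1 hb
    exact (hβ' y hy ξ b hb).trans (h _ ⟨y, hy, rfl⟩)
  · intro δ hδ hst
    have hsub : errorSet E₀ η c u δ ⊆ ⋃₀ ((fun y => errorSet E₀ η c y δ) '' Y) := by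
      rintro i ⟨hi, b, hb, hne⟩
      obtain ⟨y, hy, hb⟩ := (hu _).1 hb
      exact ⟨_, ⟨y, hy, rfl⟩, hi, b, hb, hne⟩
    obtain ⟨_, ⟨y, hy, rfl⟩, h⟩ :=
      (isStationary_sUnion_iff_of_countable cof_below_ne (hY.image _)).1 (hst.mono hsub)
    exact (hP y hy).2.2.2 δ hδ h

/-! ### Density -/

theorem countable_setOf_ladder_lt (hη : IsContinuousLadderSystem cofOmegaOne η) {δ δ' : Ordinal.{u}}
    (hδ : δ ∈ cofOmegaOne) (hlt : δ' < δ) : {i | η δ i < δ'}.Countable := by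
  obtain ⟨k, hk⟩ := (hη δ hδ).2.2 δ' hlt
  exact (countable_Iio_below k).mono fun i hi =>
    (hη δ hδ).1.strictMono.lt_iff_lt.1 (lt_of_lt_of_le hi hk)

theorem exists_extension_hasValue (hη : IsContinuousLadderSystem cofOmegaOne η) {p : ZFSet.{u}}
    (hp : p ∈ uniformizingCarrier E₀ η c) {ξ : Ordinal.{u}} (hξ : ξ < (ℵ_ 2 : Cardinal.{u}).ord)
    (b : Fin 2) (hpξ : ∀ a, ¬ HasValue p ξ a) :
    ∃ r ∈ uniformizingCarrier E₀ η c, p ⊆ r ∧ HasValue r ξ b := by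
  refine ⟨p ∪ ofGraph fun ζ a => ζ = ξ ∧ a = b,
    union_ofGraph_mem hp (succ_lt_omega_two hξ) ?_ ?_ ?_ ?_,
    fun z hz => ZFSet.mem_union.2 (Or.inl hz), hasValue_union_ofGraph.2 (Or.inr ⟨hξ, rfl, rfl⟩)⟩
  · rintro ζ a ⟨rfl, -⟩
    exact Order.lt_succ _
  · rintro ζ a a' ⟨-, rfl⟩ ⟨-, rfl⟩
    rfl
  · rintro ζ a a' ⟨rfl, -⟩
    exact hpξ a'
  · intro δ hδ
    refine Set.Subsingleton.countable ?_
    rintro i ⟨_, ⟨hi, -⟩, -⟩ j ⟨_, ⟨hj, -⟩, -⟩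
    exact (hη δ hδ).1.strictMono.injective (hi.trans hj.symm)

/-- A condition can be extended to be defined below any given `ξ < ω₂`. The ladders on the
`δ ≤ ξ` are enumerated in type at most `ω₁`, and at each new point the first ladder through
it decides the value. Two ladders share only countably many points, and each ladder has only
countably many predecessors in the enumeration, so only countably many errors are made on it. -/
theorem exists_extension_defined_below (hη : IsContinuousLadderSystem cofOmegaOne η)
    {p : ZFSet.{u}} (hp : p ∈ uniformizingCarrier E₀ η c) {ξ : Ordinal.{u}}
    (hξ : ξ < (ℵ_ 2 : Cardinal.{u}).ord) :
    ∃ r ∈ uniformizingCarrier E₀ η c, p ⊆ r ∧ ∀ ζ < ξ, ∃ b, HasValue r ζ b := by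
  classical
  have hinj : ∀ δ ∈ cofOmegaOne, Function.Injective (η δ) := fun δ hδ =>
    (hη δ hδ).1.strictMono.injective
  have hmeet : ∀ δ ∈ cofOmegaOne, ∀ δ' ∈ cofOmegaOne, δ ≠ δ' →
      {i | η δ i ∈ range (η δ')}.Countable := by
    intro δ hδ δ' hδ' hne
    rcases lt_or_gt_of_ne hne with hlt | hlt
    · refine (((countable_setOf_ladder_lt hη hδ' hlt).image (η δ')).preimage_of_injOn (f := η δ)
        (hinj δ hδ).injOn).mono ?_
      rintro i ⟨j, hj⟩
      exact ⟨j, show η δ' j < δ from hj ▸ (hη δ hδ).2.1 i, hj⟩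
    · refine (countable_setOf_ladder_lt hη hδ hlt).mono ?_
      rintro i ⟨j, hj⟩
      exact show η δ i < δ' from hj ▸ (hη δ' hδ').2.1 j
  obtain ⟨e, he⟩ : ∃ e : Ordinal.{u} → Below (ℵ_ 1 : Cardinal.{u}), InjOn e (Iic ξ) := by
    have hc := lt_omega_two_iff.1 (succ_lt_omega_two hξ)
    rw [Order.Iio_succ] at hc
    obtain ⟨f⟩ := Cardinal.le_def _ _ |>.1 hc
    refine ⟨fun δ => if h : δ ∈ Iic ξ then f ⟨δ, h⟩ else f ⟨ξ, le_refl ξ⟩, fun x hx y hy hxy => ?_⟩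
    simp only [hx, hy, dif_pos] at hxy
    exact congrArg Subtype.val (f.injective hxy)
  let T : Ordinal.{u} → Set Ordinal.{u} := fun ζ => {δ ∈ cofOmegaOne | δ ≤ ξ ∧ ζ ∈ range (η δ)}
  -- the first ladder through `ζ` is the one with least index, if any
  have hv : ∀ ζ, ∃ b : Fin 2, ∀ δ ∈ T ζ, (∀ δ' ∈ T ζ, ¬ e δ' < e δ) →
      ∀ i, η δ i = ζ → b = c δ i := by
    intro ζ
    by_cases h : ∃ δ ∈ T ζ, ∀ δ' ∈ T ζ, ¬ e δ' < e δ
    · obtain ⟨δ, hδ, hmin⟩ := h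
      obtain ⟨i, hi⟩ := hδ.2.2
      refine ⟨c δ i, fun δ' hδ' hmin' j hj => ?_⟩
      have hee : e δ = e δ' := le_antisymm (not_lt.1 (hmin δ' hδ')) (not_lt.1 (hmin' δ hδ))
      obtain rfl := he hδ.2.1 hδ'.2.1 hee
      rw [hinj δ hδ.1 (hi.trans hj.symm)]
    · exact ⟨0, fun δ hδ hmin => absurd ⟨δ, hδ, hmin⟩ h⟩
  choose v hv using hv
  refine ⟨p ∪ ofGraph fun ζ b => ζ < ξ ∧ (∀ a, ¬ HasValue p ζ a) ∧ b = v ζ,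
    union_ofGraph_mem hp hξ (fun ζ b h => h.1) ?_ (fun ζ a b h => h.2.1 b) ?_,
    fun z hz => ZFSet.mem_union.2 (Or.inl hz), ?_⟩
  · rintro ζ a b ⟨-, -, rfl⟩ ⟨-, -, rfl⟩
    rfl
  · intro δ hδ
    rcases le_or_gt δ ξ with hle | hlt
    · have hpred : {δ' | δ' ≤ ξ ∧ e δ' < e δ}.Countable := by
        refine ((countable_Iio_below (e δ)).preimage_of_injOn (f := fun x : Iic ξ => e x.1)
          (fun x _ y _ h => Subtype.ext (he x.2 y.2 h))).image Subtype.val |>.mono ?_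
        rintro δ' ⟨h₁, h₂⟩
        exact ⟨⟨δ', h₁⟩, h₂, rfl⟩
      have hpred' := hpred.mono (s₁ := {δ' | δ' ∈ cofOmegaOne ∧ δ' ≤ ξ ∧ e δ' < e δ})
        fun δ' h => h.2
      refine (hpred'.biUnion (t := fun δ' _ => {i | η δ i ∈ range (η δ')}) ?_).mono ?_
      · rintro δ' ⟨h₁, -, h₃⟩
        exact hmeet δ hδ δ' h₁ (by rintro rfl; exact lt_irrefl _ h₃)
      · rintro i ⟨b, ⟨-, -, rfl⟩, hne⟩
        by_contra hcon
        refine hne (hv _ δ ⟨hδ, hle, i, rfl⟩ (fun δ' hδ' hlt => hcon ?_) i rfl)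
        exact mem_biUnion (show δ' ∈ {δ' | δ' ∈ cofOmegaOne ∧ δ' ≤ ξ ∧ e δ' < e δ} from
          ⟨hδ'.1, hδ'.2.1, hlt⟩) hδ'.2.2
    · exact (countable_setOf_ladder_lt hη hδ hlt).mono fun i ⟨_, h, _⟩ => h.1
  · intro ζ hζ
    by_cases h : ∃ a, HasValue p ζ a
    · obtain ⟨a, ha⟩ := h
      exact ⟨a, hasValue_union_ofGraph.2 (Or.inl ha)⟩
    · exact ⟨v ζ, hasValue_union_ofGraph.2 (Or.inr ⟨hζ.trans hξ, hζ, not_exists.1 h, rfl⟩)⟩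

/-! ### Models closed under the operations of the construction -/

/-- The closure properties of a model that are used for building a generic condition: unions of
countable families of conditions, ordinals below an ordinal of the model, bounds for domains of
conditions, and extensions of conditions. -/
structure IsClosedModel (E₀ : Set (Below (ℵ_ 1 : Cardinal.{u})))
    (η : Ordinal.{u} → Below (ℵ_ 1 : Cardinal.{u}) → Ordinal.{u})
    (c : Ordinal.{u} → Below (ℵ_ 1 : Cardinal.{u}) → Fin 2) (N : ZFSet.{u}) : Prop where
  union : ∀ Y : Set ZFSet.{u}, Y.Countable → Y.Nonempty →
    (∀ y ∈ Y, y ∈ N ∧ y ∈ uniformizingCarrier E₀ η c) → ∃ u ∈ N, ∀ z, z ∈ u ↔ ∃ y ∈ Y, z ∈ y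
  ordinal_mem : ∀ ξ < (ℵ_ 2 : Cardinal.{u}).ord, ξ.toZFSet ∈ N → ∀ ζ < ξ, ζ.toZFSet ∈ N
  bound : ∀ p ∈ N, p ∈ uniformizingCarrier E₀ η c →
    ∃ β < (ℵ_ 2 : Cardinal.{u}).ord, β.toZFSet ∈ N ∧ ∀ ξ b, HasValue p ξ b → ξ < β
  extend : ∀ p ∈ N, p ∈ uniformizingCarrier E₀ η c → ∀ ξ < (ℵ_ 2 : Cardinal.{u}).ord,
    ξ.toZFSet ∈ N → ∀ b, ∃ r ∈ N, r ∈ uniformizingCarrier E₀ η c ∧ p ⊆ r ∧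
      (∀ ζ < ξ, ∃ a, HasValue r ζ a) ∧ ((∀ a, ¬ HasValue p ξ a) → HasValue r ξ b)

theorem exists_enumeration {ξ : Ordinal.{u}} (hξ : ξ < (ℵ_ 2 : Cardinal.{u}).ord) :
    ∃ e : ZFSet.{u} → ZFSet.{u}, ∀ ζ < ξ, ∃ i < (ℵ_ 1 : Cardinal.{u}).ord,
      e i.toZFSet = ζ.toZFSet := by
  obtain ⟨f⟩ := (Cardinal.le_def _ _).1 (lt_omega_two_iff.1 hξ)
  have hinj : Function.Injective fun ζ : Iio ξ => (f ζ).1.toZFSet :=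
    Ordinal.toZFSet_injective.comp (Subtype.val_injective.comp f.injective)
  exact ⟨Function.extend (fun ζ : Iio ξ => (f ζ).1.toZFSet) (fun ζ => ζ.1.toZFSet) fun _ => ∅,
    fun ζ hζ => ⟨(f ⟨ζ, hζ⟩).1, (f ⟨ζ, hζ⟩).2, hinj.extend_apply _ _ ⟨ζ, hζ⟩⟩⟩

theorem exists_extension (hη : IsContinuousLadderSystem cofOmegaOne η) {p : ZFSet.{u}}
    (hp : p ∈ uniformizingCarrier E₀ η c) {ξ : Ordinal.{u}} (hξ : ξ < (ℵ_ 2 : Cardinal.{u}).ord)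
    (b : Fin 2) : ∃ r ∈ uniformizingCarrier E₀ η c, p ⊆ r ∧
      (∀ ζ < ξ, ∃ a, HasValue r ζ a) ∧ ((∀ a, ¬ HasValue p ξ a) → HasValue r ξ b) := by
  by_cases h : ∀ a, ¬ HasValue p ξ a
  · obtain ⟨q, hq, hpq, hb⟩ := exists_extension_hasValue hη hp hξ b h
    obtain ⟨r, hr, hqr, hrξ⟩ := exists_extension_defined_below hη hq hξ
    exact ⟨r, hr, fun z hz => hqr (hpq hz), hrξ, fun _ => hqr hb⟩
  · obtain ⟨r, hr, hpr, hrξ⟩ := exists_extension_defined_below hη hp hξ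
    exact ⟨r, hr, hpr, hrξ, fun h' => absurd h' h⟩

theorem exists_parameter_isClosedModel (hη : IsContinuousLadderSystem cofOmegaOne η) :
    ∃ x : ZFSet.{u}, ∀ χ N, IsRelevant (ℵ_ 1) χ N → x ∈ N → IsClosedModel E₀ η c N := by
  let W₁ : ZFSet.{u} := (ℵ_ 1 : Cardinal.{u}).ord.toZFSet
  let W₂ : ZFSet.{u} := (ℵ_ 2 : Cardinal.{u}).ord.toZFSet
  let P : ZFSet.{u} := uniformizingCarrier E₀ η c
  -- The operations are the union of a sequence of conditions, an enumeration of an ordinal below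
  -- `ω₂` in type `ω₁`, a bound for the domain of a condition, and, for each bit `b`, the extension
  -- of conditions. The binary ones are curried, with values that are again functions in `N`.
  choose! e he using fun ξ : Ordinal.{u} => exists_enumeration (ξ := ξ)
  choose! β hβ hβ' using fun (p : ZFSet.{u}) (hp : p ∈ P) =>
    (mem_uniformizingCarrier_iff.1 hp).2.2.1
  choose! r hr hpr hrξ hrb using fun (b : Fin 2) (p : ZFSet.{u}) (ξ : Ordinal.{u}) (hp : p ∈ P)
    (hξ : ξ < (ℵ_ 2 : Cardinal.{u}).ord) => exists_extension (c := c) hη hp hξ b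
  let f : ℕ → ZFSet.{u} → ZFSet.{u} := fun n => match n with
    | 0 => fun s => ZFSet.sUnion (pairRange s)
    | 1 => fun s => graphOn (e s.rank) W₁
    | 2 => fun p => (β p).toZFSet
    | n + 3 => fun p => graphOn (fun s => r (Fin.ofNat 2 n) p s.rank) W₂
  let Y : ℕ → ZFSet.{u} := fun n => match n with
    | 0 => ZFSet.powerset (ZFSet.prod W₁ P)
    | 1 => W₂
    | 2 => P
    | _ + 3 => P
  obtain ⟨x, hx⟩ := exists_closing_parameter f Y
  refine ⟨x, fun χ N hN hxN => ?_⟩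
  obtain ⟨hord, hcl⟩ := hx χ N hN hxN
  refine ⟨?_, ?_, ?_, ?_⟩
  · intro Z hZ hne hZN
    obtain ⟨g, hg, hgZ⟩ := hN.exists_seqCode_mem hZ hne fun y hy => (hZN y hy).1
    refine ⟨_, hcl 0 _ hg (ZFSet.mem_powerset.2 (seqCode_subset_prod ?_ ?_)), fun z => ?_⟩
    · rw [← Cardinal.ord_aleph0]
      exact Cardinal.ord_le_ord.2 (Cardinal.aleph0_le_aleph 1)
    · exact fun γ hγ => (hZN _ ((hgZ _).2 ⟨γ, hγ, rfl⟩)).2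
    · simp only [f, ZFSet.mem_sUnion, mem_pairRange_seqCode, hgZ]
  · intro ξ hξ hξN ζ hζ
    have h := hcl 1 _ hξN (Ordinal.toZFSet_mem_toZFSet_iff.2 hξ)
    simp only [f, Ordinal.rank_toZFSet] at h
    obtain ⟨i, hi, hiζ⟩ := he ξ hξ ζ hζ
    rw [← hiζ]
    exact hN.elementary.apply_mem h (hord i hi) (Ordinal.toZFSet_mem_toZFSet_iff.2 hi)
  · exact fun p hpN hp => ⟨β p, hβ p hp, hcl 2 p hpN hp, hβ' p hp⟩
  · intro p hpN hp ξ hξ hξN b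
    have h := hcl (b + 3) p hpN hp
    simp only [f, Fin.ofNat_val_eq_self] at h
    have h' := hN.elementary.apply_mem h hξN (Ordinal.toZFSet_mem_toZFSet_iff.2 hξ)
    simp only [Ordinal.rank_toZFSet] at h'
    exact ⟨_, h', hr b p ξ hp hξ, hpr b p ξ hp hξ, hrξ b p ξ hp hξ, hrb b p ξ hp hξ⟩

/-! ### The construction of a generic condition -/

/-- The ordinals below `ω₂` in a closed model of size `ℵ₁` form an ordinal below `ω₂`. -/
theorem IsClosedModel.exists_height {N : ZFSet.{u}} (hN : IsClosedModel E₀ η c N)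
    (hcard : N.card ≤ ℵ_ 1) : ∃ θ < (ℵ_ 2 : Cardinal.{u}).ord,
      ∀ ξ, ξ < θ ↔ ξ < (ℵ_ 2 : Cardinal.{u}).ord ∧ ξ.toZFSet ∈ N := by
  let O : Set Ordinal.{u} := {ξ | ξ < (ℵ_ 2 : Cardinal.{u}).ord ∧ ξ.toZFSet ∈ N}
  have hO : #O ≤ #(Below (ℵ_ 1 : Cardinal.{u})) :=
    (Cardinal.mk_le_of_injective (f := fun ξ : O => (⟨ξ.1.toZFSet, ξ.2.2⟩ : N)) fun ξ ζ h =>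
      Subtype.ext (Ordinal.toZFSet_injective (congrArg Subtype.val h))).trans
      (card_le_aleph_one_iff.1 hcard)
  obtain ⟨γ, hγ, hγO⟩ := exists_lt_omega_two hO fun ξ hξ => hξ.1
  let U : Set Ordinal.{u} := {γ | ∀ ξ ∈ O, ξ < γ}
  have hU : U.Nonempty := ⟨γ, hγO⟩
  refine ⟨sInf U, (csInf_le' (show γ ∈ U from hγO)).trans_lt hγ,
    fun ξ => ⟨fun hξ => ?_, fun hξ => csInf_mem hU ξ hξ⟩⟩
  have hξU : ξ ∉ U := notMem_of_lt_csInf' hξ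
  obtain ⟨ζ, hζ, hle⟩ : ∃ ζ ∈ O, ξ ≤ ζ := by
    by_contra! h
    exact hξU h
  rcases hle.eq_or_lt with rfl | hlt
  · exact hζ
  · exact ⟨hlt.trans hζ.1, hN.ordinal_mem ζ hζ.1 hζ.2 ξ hlt⟩

/-- The condition at stage `j` of a construction with initial condition `p` and values `R k` at the
stages `k < j`. -/
def stage (p : ZFSet.{u}) (R : Below (ℵ_ 1 : Cardinal.{u}) → ZFSet.{u})
    (j : Below (ℵ_ 1 : Cardinal.{u})) : ZFSet.{u} :=
  p ∪ ZFSet.iUnion fun k : Iio j => R k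

theorem mem_stage {p : ZFSet.{u}} {R : Below (ℵ_ 1 : Cardinal.{u}) → ZFSet.{u}}
    {j : Below (ℵ_ 1 : Cardinal.{u})} {z : ZFSet.{u}} :
    z ∈ stage p R j ↔ z ∈ p ∨ ∃ k < j, z ∈ R k := by
  simp [stage]

theorem exists_stages (step : Below (ℵ_ 1 : Cardinal.{u}) → ZFSet.{u} → ZFSet.{u})
    (p : ZFSet.{u}) : ∃ R : Below (ℵ_ 1 : Cardinal.{u}) → ZFSet.{u},
      ∀ j, R j = step j (stage p R j) := by
  let F : ∀ j : Below (ℵ_ 1 : Cardinal.{u}), (∀ k, k < j → ZFSet.{u}) → ZFSet.{u} :=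
    fun j G => step j (p ∪ ZFSet.iUnion fun k : Iio j => G k.1 k.2)
  exact ⟨wellFounded_lt.fix F, fun j => wellFounded_lt.fix_eq F j⟩

/-- A sequence of conditions in `N` built by steps that extend conditions within `N`: the limit
stages stay in `N` because they are countable unions. -/
theorem IsClosedModel.exists_chain {N : ZFSet.{u}} (hN : IsClosedModel E₀ η c N) {p : ZFSet.{u}}
    (hp : p ∈ N ∧ p ∈ uniformizingCarrier E₀ η c)
    {Q : Below (ℵ_ 1 : Cardinal.{u}) → ZFSet.{u} → ZFSet.{u} → Prop}
    (hQ : ∀ j a, a ∈ N ∧ a ∈ uniformizingCarrier E₀ η c →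
      ∃ r, (r ∈ N ∧ r ∈ uniformizingCarrier E₀ η c) ∧ a ⊆ r ∧ Q j a r) :
    ∃ R : Below (ℵ_ 1 : Cardinal.{u}) → ZFSet.{u},
      (∀ j, R j ∈ N ∧ R j ∈ uniformizingCarrier E₀ η c) ∧ (∀ j, stage p R j ⊆ R j) ∧
      ∀ j, Q j (stage p R j) (R j) := by
  choose! step h₁ h₂ h₃ using hQ
  obtain ⟨R, hR⟩ := exists_stages step p
  have key : ∀ j, stage p R j ∈ N ∧ stage p R j ∈ uniformizingCarrier E₀ η c := by
    intro j
    induction j using WellFoundedLT.induction with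
    | ind j ih =>
      have hRk : ∀ k < j, R k ∈ N ∧ R k ∈ uniformizingCarrier E₀ η c := fun k hk => by
        rw [hR]
        exact h₁ k _ (ih k hk)
      have hsub : ∀ k < j, stage p R k ⊆ R k := fun k hk => by
        rw [hR k]
        exact h₂ k _ (ih k hk)
      let Y : Set ZFSet.{u} := insert p (R '' Iio j)
      have hY : Y.Countable := ((countable_Iio_below j).image R).insert p
      have hYN : ∀ y ∈ Y, y ∈ N ∧ y ∈ uniformizingCarrier E₀ η c := by
        rintro y (rfl | ⟨k, hk, rfl⟩)
        · exact hp
        · exact hRk k hk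
      have hchain : IsChain (· ⊆ ·) Y := by
        have hpR : ∀ k < j, p ⊆ R k := fun k hk z hz => hsub k hk (mem_stage.2 (Or.inl hz))
        have hRR : ∀ k l, k < l → l < j → R k ⊆ R l := fun k l hkl hl z hz =>
          hsub l hl (mem_stage.2 (Or.inr ⟨k, hkl, hz⟩))
        rintro y (rfl | ⟨k, hk, rfl⟩) z (rfl | ⟨l, hl, rfl⟩) hne
        · exact absurd rfl hne
        · exact Or.inl (hpR l hl)
        · exact Or.inr (hpR k hk)
        · rcases lt_trichotomy k l with h | rfl | h
          · exact Or.inl (hRR k l h hl)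
          · exact absurd rfl hne
          · exact Or.inr (hRR l k h hk)
      obtain ⟨u, huN, hu⟩ := hN.union Y hY ⟨p, mem_insert _ _⟩ hYN
      have hst : stage p R j = u := by
        ext z
        rw [mem_stage, hu]
        simp [Y]
      rw [hst]
      exact ⟨huN, mem_uniformizingCarrier_of_countable_chain hY (fun y hy => (hYN y hy).2)
        hchain hu⟩
  have hstep : ∀ j, (step j (stage p R j) ∈ N ∧ step j (stage p R j) ∈ uniformizingCarrier E₀ η c) ∧
      stage p R j ⊆ step j (stage p R j) ∧ Q j (stage p R j) (step j (stage p R j)) :=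
    fun j => ⟨h₁ j _ (key j), h₂ j _ (key j), h₃ j _ (key j)⟩
  simp only [← hR] at hstep
  exact ⟨R, fun j => (hstep j).1, fun j => (hstep j).2.1, fun j => (hstep j).2.2⟩

/-- Given targets `t j` for `j ∉ E₀`, there is a condition `q` that is the union of an increasing
sequence of conditions `R j` in `N` and that contains each `t j` extending all earlier conditions of
the sequence. The stages in `E₀` are used for avoiding errors at the height `N ∩ ω₂` of `N`. -/
theorem IsClosedModel.exists_condition (hη : IsContinuousLadderSystem cofOmegaOne η)
    {N : ZFSet.{u}} (hN : IsClosedModel E₀ η c N) (hcard : N.card ≤ ℵ_ 1) {p : ZFSet.{u}}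
    (hp : p ∈ N ∧ p ∈ uniformizingCarrier E₀ η c) (t : Below (ℵ_ 1 : Cardinal.{u}) → ZFSet.{u}) :
    ∃ q ∈ uniformizingCarrier E₀ η c, p ⊆ q ∧
      ∃ R : Below (ℵ_ 1 : Cardinal.{u}) → ZFSet.{u},
        (∀ j, R j ∈ N ∧ R j ∈ uniformizingCarrier E₀ η c ∧ R j ⊆ q) ∧
        ∀ j ∉ E₀, t j ∈ N → t j ∈ uniformizingCarrier E₀ η c → Order.IsSuccLimit j.1 →
          (∀ k < j, R k ⊆ t j) → t j ⊆ q := by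
  obtain ⟨θ, hθ, hθN⟩ := hN.exists_height hcard
  obtain ⟨g, hg⟩ : ∃ g : Below (ℵ_ 1 : Cardinal.{u}) → Ordinal.{u},
      ∀ ξ < θ, ∃ j, g j = ξ := by
    obtain ⟨f⟩ := (Cardinal.le_def _ _).1 (lt_omega_two_iff.1 hθ)
    exact ⟨Function.extend f (fun ξ => ξ.1) fun _ => 0,
      fun ξ hξ => ⟨f ⟨ξ, hξ⟩, f.injective.extend_apply _ _ ⟨ξ, hξ⟩⟩⟩
  have hext : ∀ a, a ∈ N ∧ a ∈ uniformizingCarrier E₀ η c → ∀ ξ b, ∃ r,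
      (r ∈ N ∧ r ∈ uniformizingCarrier E₀ η c) ∧ a ⊆ r ∧ (ξ < θ → (∀ ζ < ξ, ∃ b, HasValue r ζ b) ∧
        ((∀ b, ¬ HasValue a ξ b) → HasValue r ξ b)) := by
    intro a ha ξ b
    by_cases hξ : ξ < θ
    · obtain ⟨r, h₁, h₂, h₃, h₄⟩ := hN.extend a ha.1 ha.2 ξ ((hθN ξ).1 hξ).1 ((hθN ξ).1 hξ).2 b
      exact ⟨r, ⟨h₁, h₂⟩, h₃, fun _ => h₄⟩
    · exact ⟨a, ha, fun _ h => h, fun h => absurd h hξ⟩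
  obtain ⟨R, hRN, hRst, hQ⟩ := hN.exists_chain hp
    (Q := fun j a r => (g j < θ → ∀ ζ < g j, ∃ b, HasValue r ζ b) ∧
      (j ∈ E₀ → η θ j < θ → (∀ b, ¬ HasValue a (η θ j) b) → HasValue r (η θ j) (c θ j)) ∧
      (j ∉ E₀ → t j ∈ N → t j ∈ uniformizingCarrier E₀ η c → a ⊆ t j → t j ⊆ r)) (by
    intro j a ha
    by_cases hj : j ∈ E₀
    · obtain ⟨r₁, hr₁, har₁, h₁⟩ := hext a ha (η θ j) (c θ j)
      obtain ⟨r₂, hr₂, hrr, h₂⟩ := hext r₁ hr₁ (g j) 0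
      exact ⟨r₂, hr₂, fun z hz => hrr (har₁ hz), fun h => (h₂ h).1,
        fun _ h h' => hrr ((h₁ h).2 h'), fun h => absurd hj h⟩
    · by_cases ht : t j ∈ N ∧ t j ∈ uniformizingCarrier E₀ η c ∧ a ⊆ t j
      · obtain ⟨r, hr, har, h⟩ := hext (t j) ⟨ht.1, ht.2.1⟩ (g j) 0
        exact ⟨r, hr, fun z hz => har (ht.2.2 hz), fun h' => (h h').1, fun h => absurd h hj,
          fun _ _ _ _ => har⟩
      · obtain ⟨r, hr, har, h⟩ := hext a ha (g j) 0
        exact ⟨r, hr, har, fun h' => (h h').1, fun h => absurd h hj,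
          fun _ h₁ h₂ h₃ => absurd ⟨h₁, h₂, h₃⟩ ht⟩)
  have hP := fun j => mem_uniformizingCarrier_iff.1 (hRN j).2
  have hpR : ∀ k, p ⊆ R k := fun k z hz => hRst k (mem_stage.2 (Or.inl hz))
  have hRR : ∀ k l, k ≤ l → R k ⊆ R l := by
    intro k l hkl
    rcases hkl.eq_or_lt with rfl | h
    · exact fun _ h => h
    · exact fun z hz => hRst l (mem_stage.2 (Or.inr ⟨k, h, hz⟩))
  have hstage : ∀ j : Below (ℵ_ 1 : Cardinal.{u}), Order.IsSuccLimit j.1 → ∀ z ∈ stage p R j,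
      ∃ k < j, z ∈ R k := by
    intro j hj z hz
    rcases mem_stage.1 hz with hz | h
    · have h0 : (0 : Ordinal.{u}) < j.1 := pos_iff_ne_zero.2 (Ordinal.isSuccLimit_iff.1 hj).1
      exact ⟨⟨0, h0.trans j.2⟩, h0, hpR _ hz⟩
    · exact h
  let q : ZFSet.{u} := ZFSet.iUnion R
  have hmem : ∀ {z}, z ∈ q ↔ ∃ j, z ∈ R j := ZFSet.mem_iUnion
  have hRq : ∀ j, R j ⊆ q := fun j z hz => hmem.2 ⟨j, hz⟩
  have hfun : ∀ ξ a b, HasValue q ξ a → HasValue q ξ b → a = b := by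
    intro ξ a b ha hb
    obtain ⟨k, hk⟩ := hmem.1 ha
    obtain ⟨l, hl⟩ := hmem.1 hb
    exact (hP (max k l)).2.1 ξ a b (hRR _ _ (le_max_left _ _) hk) (hRR _ _ (le_max_right _ _) hl)
  choose β hβ hβN hβR using fun j => hN.bound (R j) (hRN j).1 (hRN j).2
  have hβθ : ∀ j, β j < θ := fun j => (hθN _).2 ⟨hβ j, hβN j⟩
  have hqθ : ∀ ξ b, HasValue q ξ b → ξ < θ := by
    intro ξ b h
    obtain ⟨j, hj⟩ := hmem.1 h
    exact (hβR j ξ b hj).trans (hβθ j)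
  refine ⟨q, mem_uniformizingCarrier_iff.2 ⟨?_, hfun, ⟨θ, hθ, hqθ⟩, ?_⟩, ?_, R,
    fun j => ⟨(hRN j).1, (hRN j).2, hRq j⟩, ?_⟩
  · intro z hz
    obtain ⟨j, hj⟩ := hmem.1 hz
    exact (hP j).1 hj
  · intro δ hδ
    rcases lt_trichotomy δ θ with hlt | rfl | hlt
    · -- below the height, some `R j` already decides the whole ladder
      obtain ⟨j, rfl⟩ := hg δ hlt
      refine fun hst => (hP j).2.2.2 _ hδ (hst.mono ?_)
      rintro i ⟨hi, b, hb, hne⟩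
      obtain ⟨b', hb'⟩ := (hQ j).1 hlt _ ((hη _ hδ).2.1 i)
      obtain rfl := hfun _ _ _ hb (hRq j hb')
      exact ⟨hi, b, hb', hne⟩
    · -- at the height, there are no errors on a club of stages `i` for which the domain of the
      -- condition at stage `i` is contained in `η δ i`
      choose h hh using fun j => (hη δ hδ).2.2 (β j) (hβθ j)
      refine not_isStationary_iff.2 ⟨_, isClub_setOf_closed h, Set.disjoint_left.2 ?_⟩
      rintro i ⟨hi, b, hb, hne⟩ ⟨hlim, hcl⟩
      have hnew : ∀ b, ¬ HasValue (stage p R i) (η δ i) b := by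
        intro b hb
        obtain ⟨k, hk, hb⟩ := hstage i hlim _ hb
        exact absurd ((hβR k _ b hb).trans_le (hh k))
          ((hη δ hδ).1.strictMono (hcl k hk)).not_gt
      have hval := (hQ i).2.1 hi ((hη δ hδ).2.1 i) hnew
      exact hne (hfun _ _ _ hb (hRq i hval))
    · -- above the height, the ladder meets the domain of `q` in countably many points
      refine not_isStationary_of_countable ((countable_setOf_ladder_lt hη hδ hlt).mono ?_)
      rintro i ⟨-, b, hb, -⟩
      exact hqθ _ b hb
  · exact fun z hz => hRq ⟨0, Cardinal.ord_pos.2 (Cardinal.aleph_pos 1)⟩ (hpR _ hz)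
  · intro j hj htN htP hlim hR z hz
    refine hRq j ((hQ j).2.2 hj htN htP ?_ hz)
    intro w hw
    obtain ⟨k, hk, hw⟩ := hstage j hlim w hw
    exact hR k hk hw

/-! ### Forcing -/

section

variable {P : Type*} [Preorder P]

theorem fEx_of_forall {ι : Sort*} {φ : ι → P → Prop} {r : P} (i : ι) (h : ∀ s ≤ r, φ i s) :
    fEx φ r :=
  fun s hs hall => hall i s le_rfl (h s hs)

theorem fImp_of_forall {φ ψ : P → Prop} {r : P} (h : ∀ s ≤ r, φ s → ∀ t ≤ s, ψ t) :
    fImp φ ψ r :=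
  fun s hs hφ => hφ.2 s le_rfl (h s hs hφ.1 s le_rfl)

theorem fImp_fGround {φ : P → Prop} {a : Prop} {r : P} (h : fImp φ (fGround a) r) (hφ : φ r) :
    a :=
  by_contra fun ha => h r le_rfl ⟨hφ, fun _ _ => ha⟩

theorem fMem_genericName_of_le {p r : P} (h : r ≤ p) : fMem p (genericName (P := P)) r :=
  fun s hs => ⟨s, le_rfl, p, rfl, hs.trans h⟩

open Classical in
/-- The canonical name of a ground model set. -/
def groundName {X : Type*} (A : Set X) : SubsetName P X := fun x => if x ∈ A then univ else ∅

theorem fMem_groundName {X : Type*} {A : Set X} {x : X} {r : P} :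
    fMem x (groundName A) r ↔ x ∈ A := by
  by_cases hx : x ∈ A
  · simp only [fMem, groundName, hx, if_true, iff_true]
    exact fun s _ => ⟨s, le_rfl, s, mem_univ s, le_rfl⟩
  · simp only [fMem, groundName, hx, if_false, iff_false]
    intro h
    obtain ⟨_, _, _, hp, _⟩ := h r le_rfl
    exact hp

theorem fMemGroundFilter_groundName {I : Type*} {D : Filter I} {A : Set I} (hA : A ∈ D) (r : P) :
    fMemGroundFilter D (groundName A) r :=
  fEx_of_forall ⟨A, hA⟩ fun _ _ _ =>
    ⟨fImp_of_forall fun _ _ h _ _ => fMem_groundName.1 h,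
      fImp_of_forall fun _ _ h _ _ => fMem_groundName.2 h⟩

theorem fMemNormalFilter_groundName {I : Type*} [LT I] {D : Filter I} {A : Set I} (hA : A ∈ D)
    (r : P) : fMemNormalFilter D (groundName A) r :=
  fEx_of_forall ⟨A, hA⟩ fun _ _ => fEx_of_forall (fun _ => groundName univ) fun s _ =>
    ⟨fun _ => fMemGroundFilter_groundName Filter.univ_mem s,
      fun _ => fImp_of_forall fun _ _ h _ _ => fMem_groundName.2 h.1⟩

end

/-- For rule genericity it is enough that, for a ground model set of `δ` in the filter, every
extension of `r` forcing `N_δ ∩ G = A_δ` lies below `q_δ`. -/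
theorem isRuleGeneric_of_forall {κ : Cardinal.{u}} {D : Filter (Below κ)} {P : ForcingNotion.{u}}
    {F : Ordinal.{u} → ZFSet.{u}} {S : Set (Below κ)} {A : Below κ → Set P.Cond}
    {q : Below κ → P.Cond} {r : P.Cond} {C : Set (Below κ)} (hC : C ∈ D)
    (h : ∀ δ ∈ S, δ ∈ C → ∀ s ≤ r, fGuesses (F δ) (A δ) s → s ≤ q δ) :
    IsRuleGeneric D P F S A q r := by
  refine fEx_of_forall (groundName C) fun s hs => ⟨fMemNormalFilter_groundName hC s, fun δ => ?_⟩
  refine fImp_of_forall fun t hts hφ v hv => fMem_genericName_of_le (hv.trans ?_)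
  exact h δ hφ.1 (fMem_groundName.1 hφ.2.1) t (hts.trans hs) hφ.2.2

/-- If `s` forces `N_δ ∩ G = A` and extends `p ∈ N_δ`, then `p ∈ A`. -/
theorem mem_of_fGuesses {P : ForcingNotion.{u}} {Nδ : ZFSet.{u}} {A : Set P.Cond} {s p : P.Cond}
    (h : fGuesses Nδ A s) (hp : p.1 ∈ Nδ) (hsp : s ≤ p) : p ∈ A :=
  fImp_fGround (h p).1 ⟨hp, fMem_genericName_of_le hsp⟩

theorem uniformizingForcing_le_iff {E₀ : Set (Below (ℵ_ 1 : Cardinal.{u}))}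
    {η : Ordinal.{u} → Below (ℵ_ 1 : Cardinal.{u}) → Ordinal.{u}}
    {c : Ordinal.{u} → Below (ℵ_ 1 : Cardinal.{u}) → Fin 2}
    {p q : (uniformizingForcing E₀ η c).Cond} : q ≤ p ↔ p.1 ⊆ q.1 := by
  change ZFSet.pair q.1 p.1 ∈ ZFSet.pairSep (fun q p => p ⊆ q) (uniformizingCarrier E₀ η c)
    (uniformizingCarrier E₀ η c) ↔ p.1 ⊆ q.1
  rw [ZFSet.mem_pairSep]
  constructor
  · rintro ⟨a, -, b, -, h, hba⟩
    obtain ⟨ha, hb⟩ := ZFSet.pair_inj.1 h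
    rwa [ha, hb]
  · exact fun h => ⟨_, q.2, _, p.2, rfl, h⟩

theorem isClub_sdiff_mem_clubFilterOff {κ : Cardinal.{u}} {C E : Set (Below κ)} (hC : IsClub C) :
    C \ E ∈ clubFilterOff κ E :=
  Filter.inter_mem_inf (Filter.mem_generate_of_mem hC) (Filter.mem_principal_self Eᶜ)

end OverDiamonds

end

theorem mainTheorem3
    (E₀ : Set (OverDiamonds.Below (ℵ_ 1 : Cardinal.{u})))
    (hE₀ : IsStationary E₀) (hE₀' : IsStationary E₀ᶜ)
    (hD : OverDiamonds.HasDiamonds (OverDiamonds.clubFilterOff (ℵ_ 1 : Cardinal.{u}) E₀))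
    (η : Ordinal.{u} → OverDiamonds.Below (ℵ_ 1 : Cardinal.{u}) → Ordinal.{u})
    (hη : OverDiamonds.IsContinuousLadderSystem OverDiamonds.cofOmegaOne η)
    (c : Ordinal.{u} → OverDiamonds.Below (ℵ_ 1 : Cardinal.{u}) → Fin 2) :
    OverDiamonds.ProperOverDiamonds
      (OverDiamonds.clubFilterOff (ℵ_ 1 : Cardinal.{u}) E₀)
      (OverDiamonds.uniformizingForcing E₀ η c) := by
  open OverDiamonds in
  obtain ⟨x, hx⟩ := exists_parameter_isClosedModel (E₀ := E₀) (c := c) hη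
  obtain ⟨χ₀, hχ₀⟩ := exists_forall_mem_hereditary x
  refine ⟨χ₀, fun χ hχ _ => ⟨x, hχ₀ χ hχ, fun N hN _ hxN F hF S A q hrule p hp => ?_⟩⟩
  obtain ⟨r, hr, hpr, R, hR, hRt⟩ := (hx χ N hN hxN).exists_condition hη hN.card_eq.le ⟨hp, p.2⟩
    fun j => (q j).1
  -- from some point on, the filtration has picked up the `j`th condition of the sequence
  choose k hk hRk using fun j => (hF.union (R j)).1 (hR j).1
  refine ⟨⟨r, hr⟩, uniformizingForcing_le_iff.2 hpr, isRuleGeneric_of_forall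
    (isClub_sdiff_mem_clubFilterOff (isClub_setOf_closed fun j => ⟨k j, hk j⟩)) ?_⟩
  rintro δ hδS ⟨⟨hlim, hcl⟩, hδE⟩ s hs hguess
  refine hs.trans (uniformizingForcing_le_iff.2 ?_)
  refine hRt δ hδE (hrule.mem δ hδS) (q δ).2 hlim fun j hj => ?_
  have hsR : s ≤ (⟨R j, (hR j).2.1⟩ : (uniformizingForcing E₀ η c).Cond) :=
    hs.trans (uniformizingForcing_le_iff.2 (hR j).2.2)
  have hmem := mem_of_fGuesses hguess
    ((hF.continuous δ.1 δ.2 hlim (R j)).2 ⟨k j, hcl j hj, hRk j⟩) hsR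
  exact uniformizingForcing_le_iff.1 (hrule.lower δ hδS _ hmem)
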